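/- Let $n\ge 1$ and let $M$ be a compact oriented smooth $n$-dimensional Riemannian manifold, possibly with boundary, with volume form $\mathrm{vol}=*1$, where $*$ is the Hodge star ($\beta\wedge *\gamma=\langle\beta,\gamma\rangle\,\mathrm{vol}$). Write $\Omega^k(M)$ for the smooth $k$-forms, and pair $\alpha\in\Omega^1(M)$ with $\omega\in\Omega^{n-1}(M)$ by $\langle\alpha,\omega\rangle=\int_M\alpha\wedge\omega$ and $f\in\Omega^0(M)$ with $\mu\in\Omega^n(M)$ by $\langle f,\mu\rangle=\int_M f\wedge\mu$. The variational derivative of a functional $F$ on $\Omega^k(M)$ at $\eta$ is the unique smooth $(n-k)$-form $\delta_\eta F$ whose pairing with every $\delta\eta\in\Omega^k(M)$ is $\frac{d}{d\epsilon}\big|_{\epsilon=0}F(\eta+\epsilon\,\delta\eta)$. For $\omega\in\Omega^{n-1}(M)$ and $\mu\in\Omega^n(M)$ let $$L_k(\omega,\mu)=\int_M\tfrac12(*\mu)\,\omega\wedge*\omega .$$ Fix $\mu\in\Omega^n(M)$ such that the function $*\mu$ (the mass density) vanishes nowhere. Then: 1. For every $\omega\in\Omega^{n-1}(M)$ the momentum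 conjugate to $\omega$, i.e. the variational derivative of $L_k(\cdot,\mu)$ at $\omega$, exists and equals $\alpha=(-1)^{n-1}(*\mu)*\omega\in\Omega^1(M)$. 2. The partial Legendre transform of $L_k$ is $$H_k(\alpha,\mu)=\int_M\frac{1}{2(*\mu)}\,\alpha\wedge*\alpha ,\qquad \alpha\in\Omega^1(M);$$ that is, every $\alpha\in\Omega^1(M)$ is the momentum conjugate to exactly one $\omega\in\Omega^{n-1}(M)$, and for this $\omega$ one has $H_k(\alpha,\mu)=\langle\alpha,\omega\rangle-L_k(\omega,\mu)$. 3. For every $\alpha\in\Omega^1(M)$ the variational derivatives of $H_k$ at $(\alpha,\mu)$ exist and are $$\delta_\alpha H_k=\frac{*\alpha}{*\mu}\in\Omega^{n-1}(M),\qquad \delta_\mu H_k=-\frac{1}{2(*\mu)^2}\,\iota_{\hat\alpha}\alpha\in\Omega^0(M),$$ where $\hat\alpha$ is the vector field metrically dual to $\alpha$ and $\iota$ is the interior product. -/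

import Mathlib

open Set MeasureTheory Bundle Manifold
open scoped ContDiff

noncomputable section

namespace FluidKinetic

/-! ### Exterior algebra of an oriented inner product space -/

section Linear

variable {k l n : ℕ}

/-- The wedge product `a ∧ b` of alternating forms: the signed sum over `(k, l)`-shuffles of
`a ⊗ b`. The degree of the result is any `n` with `k + l = n`. -/
def wedge {V : Type*} [AddCommGroup V] [Module ℝ V] (h : k + l = n)
    (a : V [⋀^Fin k]→ₗ[ℝ] ℝ) (b : V [⋀^Fin l]→ₗ[ℝ] ℝ) :
    V [⋀^Fin n]→ₗ[ℝ] ℝ :=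
  ((LinearMap.mul' ℝ ℝ).compAlternatingMap (a.domCoprod b)).domDomCongr
    (finSumFinEquiv.trans (finCongr h))

/-- The concatenation `(u₁, …, u_k, w₁, …, w_l)` of two tuples of vectors. -/
def concat {V : Type*} (h : k + l = n) (u : Fin k → V) (w : Fin l → V) : Fin n → V :=
  fun i => Sum.elim u w (finSumFinEquiv.symm (Fin.cast h.symm i))

theorem concat_update {V : Type*} [DecidableEq (Fin l)] (h : k + l = n) (u : Fin k → V)
    (w : Fin l → V) (i : Fin l) (z : V) :
    concat h u (Function.update w i z) =
      Function.update (concat h u w) (Fin.cast h (finSumFinEquiv (Sum.inr i))) z := by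
  subst h
  funext j
  obtain ⟨j, rfl⟩ := finSumFinEquiv.surjective j
  rcases j with j | j
  · have : (finSumFinEquiv (Sum.inl j) : Fin (k + l)) ≠ finSumFinEquiv (Sum.inr i) := by
      simp [-finSumFinEquiv_apply_left, -finSumFinEquiv_apply_right]
    simp only [concat, Fin.cast_refl, id_eq, Equiv.symm_apply_apply, Function.update_of_ne this,
      Sum.elim_inl]
  · by_cases hj : j = i
    · subst hj
      simp only [concat, Fin.cast_refl, id_eq, Equiv.symm_apply_apply, Function.update_self,
        Sum.elim_inr]
    · have : (finSumFinEquiv (Sum.inr j) : Fin (k + l)) ≠ finSumFinEquiv (Sum.inr i) := by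
        simpa [-finSumFinEquiv_apply_right] using hj
      simp only [concat, Fin.cast_refl, id_eq, Equiv.symm_apply_apply, Function.update_of_ne this,
        Sum.elim_inr, Function.update_of_ne hj]

/-- Insertion of the vectors `u` in the first `k` slots of `η`: the form
`w ↦ η (u₁, …, u_k, w₁, …, w_l)`. -/
def insertLeft {V : Type*} [AddCommGroup V] [Module ℝ V] (h : k + l = n)
    (η : V [⋀^Fin n]→ₗ[ℝ] ℝ) (u : Fin k → V) :
    V [⋀^Fin l]→ₗ[ℝ] ℝ where
  toFun w := η (concat h u w)
  map_update_add' w i x y := by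
    simp only [concat_update, η.map_update_add]
  map_update_smul' w i c x := by
    simp only [concat_update, η.map_update_smul]
  map_eq_zero_of_eq' w i j hw hij := by
    subst h
    refine η.map_eq_zero_of_eq _ (i := finSumFinEquiv (Sum.inr i))
      (j := finSumFinEquiv (Sum.inr j)) ?_ ?_
    · simpa only [concat, Fin.cast_refl, id_eq, Equiv.symm_apply_apply, Sum.elim_inr] using hw
    · simpa [-finSumFinEquiv_apply_right] using hij

variable {V : Type*} [NormedAddCommGroup V] [InnerProductSpace ℝ V] [FiniteDimensional ℝ V]

/-- The Hodge star of a `k`-form, in an orthonormal basis `e`: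
`(*b)(w) = (1 / k!) ∑ b(e_{i₁}, …, e_{i_k}) vol(e_{i₁}, …, e_{i_k}, w)`, the sum being over all
`k`-tuples of indices. This is the form with `a ∧ *b = ⟨a, b⟩ vol` for all `k`-forms `a`; it does
not depend on the orthonormal basis. -/
def hodge [Fact (Module.finrank ℝ V = n)] (o : Orientation ℝ V (Fin n)) (h : k + l = n)
    (b : V [⋀^Fin k]→ₗ[ℝ] ℝ) : V [⋀^Fin l]→ₗ[ℝ] ℝ :=
  ((k.factorial : ℝ)⁻¹) • ∑ f : Fin k → Fin (Module.finrank ℝ V),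
    b (fun i => stdOrthonormalBasis ℝ V (f i)) •
      insertLeft h o.volumeForm (fun i => stdOrthonormalBasis ℝ V (f i))

/-- The vector `â` metrically dual to a `1`-form `a`: `⟨â, w⟩ = a(w)`. -/
def sharp (a : V [⋀^Fin 1]→ₗ[ℝ] ℝ) : V :=
  (InnerProductSpace.toDual ℝ V).symm
    (LinearMap.toContinuousLinearMap ((AlternatingMap.ofSubsingleton ℝ V ℝ (0 : Fin 1)).symm a))

end Linear

/-! ### Differential forms on a manifold (possibly with boundary) -/

section Forms

variable {n : ℕ} {H : Type*} [TopologicalSpace H]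
  (I : ModelWithCorners ℝ (EuclideanSpace ℝ (Fin n)) H)
  (M : Type*) [TopologicalSpace M] [ChartedSpace H M]

/-- Fields of alternating `k`-forms on the tangent spaces of `M`, without regularity. -/
abbrev DiffForm (k : ℕ) : Type _ := ∀ x : M, (TangentSpace I x) [⋀^Fin k]→ₗ[ℝ] ℝ

variable {I M}

/-- The expression of a form in the chart around `x₀`: its pullback under the inverse chart. -/
def chartPullback {k : ℕ} (x₀ : M) (η : DiffForm I M k) (y : EuclideanSpace ℝ (Fin n)) :
    (EuclideanSpace ℝ (Fin n)) [⋀^Fin k]→ₗ[ℝ] ℝ :=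
  (η ((extChartAt I x₀).symm y)).compLinearMap
    (mfderivWithin 𝓘(ℝ, EuclideanSpace ℝ (Fin n)) I (extChartAt I x₀).symm (range I) y).toLinearMap

/-- A form is smooth if its components in every chart are smooth. -/
def IsSmoothForm {k : ℕ} (η : DiffForm I M k) : Prop :=
  ∀ (x₀ : M) (v : Fin k → EuclideanSpace ℝ (Fin n)),
    ContDiffOn ℝ ∞ (fun y => chartPullback x₀ η y v) (extChartAt I x₀).target

/-- The standard basis of the model space. -/
def stdFrame (n : ℕ) : Fin n → EuclideanSpace ℝ (Fin n) := fun i => EuclideanSpace.single i 1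

/-- The sign (`1` or `-1`) of the coordinate frame of the chart around `x₀`, at the point with
coordinates `y`, with respect to a choice of orientations of the tangent spaces. -/
def chartSign (o : ∀ x : M, Orientation ℝ (TangentSpace I x) (Fin n)) (x₀ : M)
    (y : EuclideanSpace ℝ (Fin n)) : ℝ :=
  SignType.sign (chartPullback x₀ (fun x => (o x).someVector) y (stdFrame n))

variable (I M) in
/-- An orientation of `M`: orientations of all tangent spaces such that the sign of the coordinate
frame of every chart is locally constant. -/
structure ManifoldOrientation where
  /-- the orientation of the tangent space at `x` -/
  orient (x : M) : Orientation ℝ (TangentSpace I x) (Fin n)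
  continuousOn_chartSign (x₀ : M) : ContinuousOn (chartSign orient x₀) (extChartAt I x₀).target

variable [IsManifold I ∞ M] [CompactSpace M] [T2Space M]

variable (I M) in
/-- A smooth partition of unity subordinate to the covering of `M` by its charts. -/
def partitionOfUnity : SmoothPartitionOfUnity M I M univ :=
  (SmoothPartitionOfUnity.exists_isSubordinate_chartAt_source I M).choose

/-- The integral over the oriented compact manifold `M` of a form of top degree: the sum over a
partition of unity `ρ` subordinate to the charts of the integrals of the coordinate expressions of
`ρᵢ η`, with the sign `-1` where the chart reverses orientation. -/
def formIntegral (o : ManifoldOrientation I M) (η : DiffForm I M n) : ℝ :=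
  ∑ᶠ x₀ : M, ∫ y in (extChartAt I x₀).target,
    chartSign o.orient x₀ y * partitionOfUnity I M x₀ ((extChartAt I x₀).symm y) *
      chartPullback x₀ η y (stdFrame n)

/-- The pairing `∫_M a ∧ b` of forms of complementary degrees. -/
def pairing {k l : ℕ} (o : ManifoldOrientation I M) (h : k + l = n) (a : DiffForm I M k)
    (b : DiffForm I M l) : ℝ :=
  formIntegral o fun x => wedge h (a x) (b x)

end Forms

/-! ### Variational derivatives and Legendre transforms -/

section Variational

variable {n : ℕ} {H : Type*} [TopologicalSpace H]
  {I : ModelWithCorners ℝ (EuclideanSpace ℝ (Fin n)) H}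
  {M : Type*} [TopologicalSpace M] [ChartedSpace H M]

/-- `d` represents, through the pairing `B`, the directional derivatives of the functional `F` at
`η` in all smooth directions `δ`. -/
def RepresentsDeriv {k l : ℕ} (B : DiffForm I M l → DiffForm I M k → ℝ)
    (F : DiffForm I M k → ℝ) (η : DiffForm I M k) (d : DiffForm I M l) : Prop :=
  ∀ δ : DiffForm I M k, IsSmoothForm δ → HasDerivAt (fun ε : ℝ => F (η + ε • δ)) (B d δ) 0

/-- `d` is the variational derivative of `F` at `η`: the unique smooth form that represents the
directional derivatives of `F` at `η` through the pairing `B`. -/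
def IsVariationalDeriv {k l : ℕ} (B : DiffForm I M l → DiffForm I M k → ℝ)
    (F : DiffForm I M k → ℝ) (η : DiffForm I M k) (d : DiffForm I M l) : Prop :=
  IsSmoothForm d ∧ RepresentsDeriv B F η d ∧
    ∀ d' : DiffForm I M l, IsSmoothForm d' → RepresentsDeriv B F η d' → d' = d

/-- `K` is the Legendre transform of `L` with respect to the pairing `B`: every smooth `β` has a
conjugate momentum (the variational derivative of `L` at `β`), every smooth `α` is the momentum of
exactly one smooth `β`, and `K(α) = B(α, β) - L(β)` whenever `α` is the momentum of `β`. -/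
def IsLegendreTransform {k l : ℕ} (B : DiffForm I M l → DiffForm I M k → ℝ)
    (L : DiffForm I M k → ℝ) (K : DiffForm I M l → ℝ) : Prop :=
  (∀ β : DiffForm I M k, IsSmoothForm β → ∃ α, IsVariationalDeriv B L β α) ∧
  (∀ α : DiffForm I M l, IsSmoothForm α →
    ∃! β : DiffForm I M k, IsSmoothForm β ∧ IsVariationalDeriv B L β α) ∧
  ∀ (β : DiffForm I M k) (α : DiffForm I M l), IsSmoothForm β → IsVariationalDeriv B L β α →
    K α = B α β - L β

end Variational

/-! ### The kinetic energy on an oriented Riemannian manifold -/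

section Kinetic

variable {n : ℕ} {H : Type*} [TopologicalSpace H]
  {I : ModelWithCorners ℝ (EuclideanSpace ℝ (Fin n)) H}
  {M : Type*} [TopologicalSpace M] [ChartedSpace H M]

instance finiteDimensional_tangentSpace (x : M) : FiniteDimensional ℝ (TangentSpace I x) :=
  inferInstanceAs (FiniteDimensional ℝ (EuclideanSpace ℝ (Fin n)))

instance fact_finrank_tangentSpace (x : M) :
    Fact (Module.finrank ℝ (TangentSpace I x) = n) :=
  ⟨finrank_euclideanSpace_fin (𝕜 := ℝ)⟩

variable [RiemannianBundle (fun x : M => TangentSpace I x)]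

/-- The Hodge star on forms. -/
def hodgeStar {k l : ℕ} (o : ManifoldOrientation I M) (h : k + l = n) (η : DiffForm I M k) :
    DiffForm I M l :=
  fun x => hodge (o.orient x) h (η x)

/-- The `0`-form `*μ` of a top form `μ`, as a function. -/
def density (o : ManifoldOrientation I M) (μ : DiffForm I M n) (x : M) : ℝ :=
  hodgeStar o (Nat.add_zero n) μ x Fin.elim0

/-- The momentum `(-1)^(n-1) (*μ) *β`. -/
def momentum (hn : 1 ≤ n) (o : ManifoldOrientation I M) (β : DiffForm I M (n - 1))
    (μ : DiffForm I M n) : DiffForm I M 1 :=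
  fun x => ((-1) ^ (n - 1) * density o μ x) • hodgeStar o (Nat.sub_add_cancel hn) β x

/-- The `(n-1)`-form `*α / *μ`. -/
def velocityForm (hn : 1 ≤ n) (o : ManifoldOrientation I M) (α : DiffForm I M 1)
    (μ : DiffForm I M n) : DiffForm I M (n - 1) :=
  fun x => (density o μ x)⁻¹ • hodgeStar o (Nat.add_sub_of_le hn) α x

/-- The `0`-form `-(1 / (2 (*μ)²)) ι_α̂ α`. -/
def massEffort (o : ManifoldOrientation I M) (α : DiffForm I M 1) (μ : DiffForm I M n) :
    DiffForm I M 0 :=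
  fun x => (-(1 / (2 * density o μ x ^ 2))) • (α x).curryLeft (sharp (α x))

variable [IsManifold I ∞ M] [CompactSpace M] [T2Space M]

/-- The reduced Lagrangian `L_k(β, μ) = ∫_M ½ (*μ) β ∧ *β`. -/
def lagrangian (hn : 1 ≤ n) (o : ManifoldOrientation I M) (β : DiffForm I M (n - 1))
    (μ : DiffForm I M n) : ℝ :=
  formIntegral o fun x => (1 / 2 * density o μ x) •
    wedge (Nat.sub_add_cancel hn) (β x) (hodgeStar o (Nat.sub_add_cancel hn) β x)

/-- The Hamiltonian `H_k(α, μ) = ∫_M (1 / (2 (*μ))) α ∧ *α`. -/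
def hamiltonian (hn : 1 ≤ n) (o : ManifoldOrientation I M) (α : DiffForm I M 1)
    (μ : DiffForm I M n) : ℝ :=
  formIntegral o fun x => (1 / (2 * density o μ x)) •
    wedge (Nat.add_sub_of_le hn) (α x) (hodgeStar o (Nat.add_sub_of_le hn) α x)

end Kinetic

end FluidKinetic

end

open FluidKinetic

/-! Everything reduces to pointwise linear algebra and to integrals of functions against the volume
form. At each point `a ∧ *b = ⟨a, b⟩ vol` (`wedge_hodge`), where `contract` is the inner product of
forms. Hence, with `ρ = *μ`, the Lagrangian is `∫ ½ ρ |β|² vol` and the Hamiltonian is `∫ (1/(2ρ))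
|α|² vol`. Both are quadratic in the first argument, so along a line `η + ε δ` they are polynomials
of degree two in `ε`, and the derivative is the coefficient of `ε`
(`hasDerivAt_volIntegral_contract`). Graded commutativity of the wedge (`wedge_comm_one`) identifies
this coefficient with the pairing against `(-1)^(n-1) ρ *β`, respectively `*α / ρ`.

Since `** = (-1)^(n-1)` on `1`-forms (`hodge_hodge_one`) and `ρ` has no zero, `α ↦ *α / ρ` inverts
the momentum map. For corresponding `α` and `β` the pairing equals both `2 L` and `2 H`, whence `H =
⟨α, β⟩ - L`. The dependence on `μ` is not polynomial; there `1/(ρ + ε σ)` is expanded to first order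
with an explicit remainder, bounded uniformly by compactness (`hasDerivAt_volIntegral_inv`).

Uniqueness of variational derivatives is the fundamental lemma of the calculus of variations:
testing a difference `c` of two smooth candidates against `*c` gives `∫ |c|² vol = 0`, so `c = 0`
(`eq_zero_of_volIntegral_eq_zero`). This needs the Hodge star to preserve smoothness, which is seen
from its formula in a coordinate frame through the inverse Gram matrix. -/

namespace FluidKinetic

/-! ### Algebra of the wedge product. -/

section Wedge

variable {k l n : ℕ} {V : Type*} [AddCommGroup V] [Module ℝ V]

theorem wedge_apply (h : k + l = n) (a : V [⋀^Fin k]→ₗ[ℝ] ℝ) (b : V [⋀^Fin l]→ₗ[ℝ] ℝ)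
    (v : Fin n → V) :
    wedge h a b v = LinearMap.mul' ℝ ℝ
      (a.domCoprod b fun s => v (finCongr h (finSumFinEquiv s))) := rfl

theorem wedge_smul_right (h : k + l = n) (a : V [⋀^Fin k]→ₗ[ℝ] ℝ) (c : ℝ)
    (b : V [⋀^Fin l]→ₗ[ℝ] ℝ) : wedge h a (c • b) = c • wedge h a b := by
  ext v
  simp only [wedge_apply, ← AlternatingMap.domCoprod'_apply, TensorProduct.tmul_smul, map_smul,
    AlternatingMap.smul_apply]

theorem wedge_smul_left (h : k + l = n) (a : V [⋀^Fin k]→ₗ[ℝ] ℝ) (c : ℝ)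
    (b : V [⋀^Fin l]→ₗ[ℝ] ℝ) : wedge h (c • a) b = c • wedge h a b := by
  ext v
  simp only [wedge_apply, ← AlternatingMap.domCoprod'_apply, ← TensorProduct.smul_tmul', map_smul,
    AlternatingMap.smul_apply]

theorem wedge_sub_right (h : k + l = n) (a : V [⋀^Fin k]→ₗ[ℝ] ℝ)
    (b b' : V [⋀^Fin l]→ₗ[ℝ] ℝ) : wedge h a (b - b') = wedge h a b - wedge h a b' := by
  ext v
  simp only [wedge_apply, ← AlternatingMap.domCoprod'_apply, TensorProduct.tmul_sub, map_sub,
    AlternatingMap.sub_apply]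

theorem wedge_add_right (h : k + l = n) (a : V [⋀^Fin k]→ₗ[ℝ] ℝ)
    (b b' : V [⋀^Fin l]→ₗ[ℝ] ℝ) : wedge h a (b + b') = wedge h a b + wedge h a b' := by
  ext v
  simp only [wedge_apply, ← AlternatingMap.domCoprod'_apply, TensorProduct.tmul_add, map_add,
    AlternatingMap.add_apply]

theorem wedge_sum_right {ι : Type*} (s : Finset ι) (h : k + l = n) (a : V [⋀^Fin k]→ₗ[ℝ] ℝ)
    (b : ι → V [⋀^Fin l]→ₗ[ℝ] ℝ) : wedge h a (∑ i ∈ s, b i) = ∑ i ∈ s, wedge h a (b i) :=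
  map_sum (AddMonoidHom.mk' (wedge h a) (wedge_add_right h a)) b s

/-- The wedge product as a normalized sum over all permutations. -/
theorem factorial_mul_wedge_apply (h : k + l = n) (a : V [⋀^Fin k]→ₗ[ℝ] ℝ)
    (b : V [⋀^Fin l]→ₗ[ℝ] ℝ) (v : Fin n → V) :
    ((k.factorial : ℝ) * l.factorial) * wedge h a b v =
      ∑ σ : Equiv.Perm (Fin k ⊕ Fin l), ((Equiv.Perm.sign σ : ℤ) : ℝ) *
        (a (fun i => v (finCongr h (finSumFinEquiv (σ (Sum.inl i))))) *
          b (fun i => v (finCongr h (finSumFinEquiv (σ (Sum.inr i)))))) := by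
  have := congrArg (fun m => LinearMap.mul' ℝ ℝ
    (m fun s => v (finCongr h (finSumFinEquiv s)))) (MultilinearMap.domCoprod_alternization_eq a b)
  simp only [Fintype.card_fin, MultilinearMap.alternatization_apply, map_sum,
    AlternatingMap.smul_apply, map_nsmul] at this
  rw [wedge_apply, ← Nat.cast_mul, ← nsmul_eq_mul, ← this]
  refine Finset.sum_congr rfl fun σ _ => ?_
  rw [Units.smul_def, map_zsmul, zsmul_eq_mul]
  rfl

/-- The permutation of `Fin n` that exchanges an initial block with the complementary one. -/
def blockSwap (h : k + l = n) (h' : l + k = n) : Equiv.Perm (Fin n) :=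
  (finCongr h).symm.trans (finAddFlip.trans (finCongr h'))

theorem blockSwap_apply (h : k + l = n) (h' : l + k = n) (s : Fin k ⊕ Fin l) :
    blockSwap h h' (finCongr h (finSumFinEquiv s)) = finCongr h' (finSumFinEquiv s.swap) := by
  rcases s with s | s <;> simp [blockSwap]

/-- In the sum over all permutations, conjugation by the exchange of the two summands of `Fin k ⊕
Fin l` preserves signs and swaps the two factors. The only sign left comes from permuting the
arguments by the block exchange. -/
theorem wedge_comm_apply (h : k + l = n) (h' : l + k = n) (a : V [⋀^Fin k]→ₗ[ℝ] ℝ)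
    (b : V [⋀^Fin l]→ₗ[ℝ] ℝ) :
    wedge h' b a = ((Equiv.Perm.sign (blockSwap h h') : ℤ) : ℝ) • wedge h a b := by
  ext v
  have h1 := factorial_mul_wedge_apply h' b a v
  have h2 := factorial_mul_wedge_apply h a b (v ∘ blockSwap h h')
  rw [AlternatingMap.map_perm, Units.smul_def, zsmul_eq_mul] at h2
  have h0 : ((k.factorial : ℝ) * l.factorial) ≠ 0 := by positivity
  refine mul_left_cancel₀ h0 ?_
  rw [AlternatingMap.smul_apply, smul_eq_mul, h2, mul_comm (k.factorial : ℝ), h1]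
  refine Fintype.sum_equiv ((Equiv.sumComm (Fin l) (Fin k)).permCongr) _ _ fun σ => ?_
  simp only [Function.comp_apply, blockSwap_apply, Equiv.Perm.sign_permCongr]
  rw [mul_comm (b _)]
  simp [Equiv.permCongr_apply, -finSumFinEquiv_apply_left, -finSumFinEquiv_apply_right]

/-- Moving a single last element to the front is a cyclic rotation of `n` letters. -/
theorem sign_blockSwap_one (h : (n - 1) + 1 = n) (h' : 1 + (n - 1) = n) :
    Equiv.Perm.sign (blockSwap h h') = (-1) ^ (n - 1) := by
  obtain ⟨m, rfl⟩ : ∃ m, n = m + 1 := ⟨n - 1, h.symm⟩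
  have : blockSwap h h' = finRotate (m + 1) := rfl
  rw [this, sign_finRotate]

theorem wedge_comm_one (h : (n - 1) + 1 = n) (h' : 1 + (n - 1) = n)
    (a : V [⋀^Fin (n - 1)]→ₗ[ℝ] ℝ) (b : V [⋀^Fin 1]→ₗ[ℝ] ℝ) :
    wedge h' b a = (-1 : ℝ) ^ (n - 1) • wedge h a b := by
  rw [wedge_comm_apply h h', sign_blockSwap_one]
  simp

theorem concat_apply {V : Type*} (h : k + l = n) (u : Fin k → V) (w : Fin l → V)
    (s : Fin k ⊕ Fin l) :
    concat h u w (finCongr h (finSumFinEquiv s)) = Sum.elim u w s := by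
  simp [concat, -finSumFinEquiv_apply_left, -finSumFinEquiv_apply_right]

theorem concat_comp {V W : Type*} (h : k + l = n) (u : Fin k → V) (w : Fin l → V) (g : V → W) :
    concat h (fun i => g (u i)) (fun i => g (w i)) = fun i => g (concat h u w i) := by
  funext i
  simp only [concat]
  rcases finSumFinEquiv.symm (Fin.cast h.symm i) with j | j <;> rfl

/-- Supplies the adapted basis in which the shuffle sum of `wedge_insertLeft` collapses to one term.
-/
theorem exists_basis_extending [FiniteDimensional ℝ V] (h : k + l = n)
    (hV : Module.finrank ℝ V = n) (u : Fin k → V) (hu : LinearIndependent ℝ u) :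
    ∃ b : Module.Basis (Fin k ⊕ Fin l) ℝ V, ∀ i, b (Sum.inl i) = u i := by
  let b := Module.Basis.sumExtend hu
  have : Finite (Fin k ⊕ Module.Basis.sumExtendIndex hu) := Module.Finite.finite_basis b
  have : Finite (Module.Basis.sumExtendIndex hu) :=
    Finite.of_injective _ (Sum.inr_injective (α := Fin k))
  have := Fintype.ofFinite (Module.Basis.sumExtendIndex hu)
  have hc : Fintype.card (Module.Basis.sumExtendIndex hu) = Fintype.card (Fin l) := by
    have := Module.finrank_eq_card_basis b
    rw [Fintype.card_sum, Fintype.card_fin, hV] at this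
    rw [Fintype.card_fin]
    lia
  refine ⟨b.reindex ((Equiv.refl _).sumCongr (Fintype.equivOfCardEq hc)), fun i => ?_⟩
  simp only [b, Module.Basis.sumExtend, Module.Basis.reindex_apply, Equiv.sumCongr_symm,
    Equiv.sumCongr_apply, Sum.map_inl, Equiv.refl_symm, Equiv.refl_apply,
    Module.Basis.extend_apply_self]
  rfl

/-- For a form `η` of top degree, `a ∧ η(u, ·) = a(u) η`. -/
theorem wedge_insertLeft [FiniteDimensional ℝ V] (h : k + l = n)
    (hV : Module.finrank ℝ V = n) (a : V [⋀^Fin k]→ₗ[ℝ] ℝ) (η : V [⋀^Fin n]→ₗ[ℝ] ℝ)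
    (u : Fin k → V) : wedge h a (insertLeft h η u) = a u • η := by
  by_cases hu : LinearIndependent ℝ u
  · obtain ⟨b, hb⟩ := exists_basis_extending h hV u hu
    let b' := b.reindex (finSumFinEquiv.trans (finCongr h))
    suffices hs : wedge h a (insertLeft h η u) b' = (a u • η) b' by
      rw [(wedge h a (insertLeft h η u)).eq_smul_basis_det b', (a u • η).eq_smul_basis_det b', hs]
    have hb' : (fun s => b' (finCongr h (finSumFinEquiv s))) = b := by
      funext s
      simp [b', -finSumFinEquiv_apply_left, -finSumFinEquiv_apply_right]
    rw [wedge_apply, hb', AlternatingMap.domCoprod_apply, sum_apply, map_sum]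
    -- Only the identity shuffle survives: any other one feeds some `u i` to `η(u, ·)`, so that `η`
    -- gets a repeated argument.
    refine (Finset.sum_eq_single (Quotient.mk'' 1 : Equiv.Perm.ModSumCongr (Fin k) (Fin l))
      ?_ ?_).trans ?_
    · intro σ _ hσ
      induction σ using Quotient.inductionOn' with | _ σ
      have hz : insertLeft h η u (fun i => b (σ (Sum.inr i))) = 0 := by
        by_contra hne
        refine hσ ?_
        have hm : MapsTo σ (range Sum.inr) (range Sum.inr) := by
          rintro _ ⟨j, rfl⟩
          rcases hj : σ (Sum.inr j) with i | i
          · refine absurd ?_ hne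
            refine η.map_eq_zero_of_eq _ (i := finCongr h (finSumFinEquiv (Sum.inl i)))
              (j := finCongr h (finSumFinEquiv (Sum.inr j))) ?_ ?_
            · rw [concat_apply, concat_apply, Sum.elim_inl, Sum.elim_inr, hj, hb]
            · simp [-finSumFinEquiv_apply_left, -finSumFinEquiv_apply_right]
          · exact ⟨i, rfl⟩
        have := Equiv.Perm.mem_sumCongrHom_range_of_perm_mapsTo_inl
          ((Equiv.Perm.perm_mapsTo_inl_iff_mapsTo_inr σ).2 hm)
        refine (Quotient.sound' ?_).symm
        rw [QuotientGroup.leftRel_apply]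
        simpa using this
      rw [AlternatingMap.domCoprod.summand_mk'']
      simp [hz]
    · simp
    · rw [AlternatingMap.domCoprod.summand_mk'']
      have h1 : concat h u (fun i => b (Sum.inr i)) = b' := by
        funext j
        obtain ⟨s, rfl⟩ := (finSumFinEquiv.trans (finCongr h)).surjective j
        rw [← hb'] at hb ⊢
        rw [Equiv.trans_apply, concat_apply]
        rcases s with s | s
        · rw [Sum.elim_inl, ← hb]
        · rfl
      have h2 : (fun i => b (Sum.inl i)) = u := funext hb
      have h3 : insertLeft h η u (fun i => b (Sum.inr i)) = η b' := by rw [← h1]; rfl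
      simp [h2, h3]
  -- For dependent `u` both sides vanish, because `η` receives a dependent family as well.
  · rw [a.map_linearDependent u hu, zero_smul]
    have : insertLeft h η u = 0 := by
      ext w
      refine η.map_linearDependent _ fun hc => hu ?_
      have := hc.comp (fun i : Fin k => finCongr h (finSumFinEquiv (Sum.inl i)))
        (by intro i j hij; simpa using hij)
      have hu' : (concat h u w ∘ fun i : Fin k => finCongr h (finSumFinEquiv (Sum.inl i))) = u :=
        funext fun i => concat_apply h u w (Sum.inl i)
      rwa [hu'] at this
    rw [this, ← zero_smul ℝ (0 : V [⋀^Fin l]→ₗ[ℝ] ℝ), wedge_smul_right, zero_smul]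

end Wedge

/-! ### Inner product of forms and pointwise Hodge theory. -/

section Contract

theorem alternatingMap_sum_apply {ι κ : Type*} {V : Type*} [AddCommGroup V] [Module ℝ V]
    (s : Finset κ) (f : κ → V [⋀^ι]→ₗ[ℝ] ℝ) (v : ι → V) : (∑ i ∈ s, f i) v = ∑ i ∈ s, f i v :=
  map_sum (AddMonoidHom.mk' (fun g : V [⋀^ι]→ₗ[ℝ] ℝ => g v) fun _ _ => rfl) f s

/-- Non-injective index maps repeat an argument and contribute zero; the injective ones on a finite
type are the permutations. -/
theorem alternating_sum_eq_sum_perm {ι : Type*} [Fintype ι] [DecidableEq ι] {V : Type*}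
    [AddCommGroup V] [Module ℝ V] (η : V [⋀^ι]→ₗ[ℝ] ℝ) (e : ι → V) (F : (ι → ι) → ℝ) :
    ∑ g : ι → ι, η (fun i => e (g i)) * F g =
      ∑ σ : Equiv.Perm ι, ((Equiv.Perm.sign σ : ℤ) : ℝ) * η e * F σ := by
  refine (Fintype.sum_of_injective (fun σ : Equiv.Perm ι => (σ : ι → ι))
    DFunLike.coe_injective _ _ ?_ ?_).symm
  · intro g hg
    have : ¬ Function.Injective g := fun hi =>
      hg ⟨Equiv.ofBijective g (Finite.injective_iff_bijective.1 hi), rfl⟩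
    simp only [Function.Injective, not_forall] at this
    obtain ⟨i, j, hij, hne⟩ := this
    rw [η.map_eq_zero_of_eq (fun i => e (g i)) (congrArg e hij) hne, zero_mul]
  · intro σ
    have : η (fun i => e (σ i)) = Equiv.Perm.sign σ • η e := η.map_perm e σ
    rw [this, Units.smul_def, zsmul_eq_mul]

variable {k l n : ℕ} {V : Type*} [NormedAddCommGroup V] [InnerProductSpace ℝ V]

/-- The Gram matrix of a family of vectors. -/
def gram {κ : Type*} (v : κ → V) : Matrix κ κ ℝ := Matrix.of fun i j => inner ℝ (v i) (v j)

/-- If `A` holds the coordinates of the orthonormal basis `e` in `v`, then `A Aᵀ` is the inverse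
metric; this is the expansion of `v i` in `e`. It yields both invertibility of the Gram matrix and
the formula for `contract` in any basis. -/
theorem gram_mul_sum_repr {ι κ : Type*} [Fintype ι] [Fintype κ] [DecidableEq κ]
    (e : OrthonormalBasis ι ℝ V) (v : Module.Basis κ ℝ V) :
    gram v * Matrix.of (fun i j => ∑ p, v.repr (e p) i * v.repr (e p) j) = 1 := by
  ext i j
  simp only [Matrix.mul_apply, gram, Matrix.of_apply]
  have h1 : ∀ p, ∑ m, inner ℝ (v i) (v m) * v.repr (e p) m = inner ℝ (v i) (e p) := by
    intro p
    conv_rhs => rw [← v.sum_repr (e p), inner_sum]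
    exact Finset.sum_congr rfl fun m _ => by rw [inner_smul_right, mul_comm]
  calc ∑ m, inner ℝ (v i) (v m) * ∑ p, v.repr (e p) m * v.repr (e p) j
      = ∑ p, (∑ m, inner ℝ (v i) (v m) * v.repr (e p) m) * v.repr (e p) j := by
        simp only [Finset.mul_sum, Finset.sum_mul]
        rw [Finset.sum_comm]
        exact Finset.sum_congr rfl fun _ _ => Finset.sum_congr rfl fun _ _ => by ring
    _ = v.repr (∑ p, inner ℝ (e p) (v i) • e p) j := by
        simp only [h1, map_sum, map_smul, Finsupp.finsetSum_apply, Finsupp.smul_apply, smul_eq_mul]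
        exact Finset.sum_congr rfl fun _ _ => by rw [real_inner_comm]
    _ = (1 : Matrix κ κ ℝ) i j := by
        rw [e.sum_repr', v.repr_self, Matrix.one_apply, Finsupp.single_apply]

theorem volumeForm_mul_self [Fact (Module.finrank ℝ V = n)]
    (o : Orientation ℝ V (Fin n)) (e : OrthonormalBasis (Fin n) ℝ V) :
    o.volumeForm e * o.volumeForm e = 1 := by
  rw [← abs_mul_abs_self, o.abs_volumeForm_apply_of_orthonormal, one_mul]

/-- `chartSign` is defined through an arbitrary representative of the orientation ray; this allows
computing it with the metric volume form instead. -/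
theorem exists_someVector_eq_smul_volumeForm [Fact (Module.finrank ℝ V = n)]
    (o : Orientation ℝ V (Fin n)) (hn : 0 < n) :
    ∃ c : ℝ, 0 < c ∧ o.someVector = c • o.volumeForm := by
  let b := o.finOrthonormalBasis hn Fact.out
  have hb : b.toBasis.orientation = o := o.finOrthonormalBasis_orientation hn Fact.out
  rw [o.volumeForm_robust b hb]
  have h1 := o.someVector_ray
  conv_rhs at h1 => rw [← hb]
  rw [Module.Basis.orientation, ray_eq_iff] at h1
  obtain ⟨r, hr, h⟩ := h1.symm.exists_pos_left b.toBasis.det_ne_zero o.someVector_ne_zero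
  exact ⟨r, hr, h.symm⟩

variable [FiniteDimensional ℝ V]

/-- The contraction `(1 / k!) ∑ b(e_{i₁}, …, e_{i_k}) c(e_{i₁}, …, e_{i_k})` of two functions of
`k` vectors in an orthonormal basis. On `k`-forms it is the inner product. -/
noncomputable def contract (b c : (Fin k → V) → ℝ) : ℝ :=
  (k.factorial : ℝ)⁻¹ * ∑ f : Fin k → Fin (Module.finrank ℝ V),
    b (fun i => stdOrthonormalBasis ℝ V (f i)) * c (fun i => stdOrthonormalBasis ℝ V (f i))

theorem contract_comm (b c : (Fin k → V) → ℝ) : contract b c = contract c b := by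
  simp only [contract, mul_comm]

theorem contract_add_left (b b' c : (Fin k → V) → ℝ) :
    contract (b + b') c = contract b c + contract b' c := by
  simp only [contract, Pi.add_apply, add_mul, Finset.sum_add_distrib, mul_add]

theorem contract_smul_left (r : ℝ) (b c : (Fin k → V) → ℝ) :
    contract (r • b) c = r * contract b c := by
  simp only [contract, Pi.smul_apply, smul_eq_mul, Finset.mul_sum]
  exact Finset.sum_congr rfl fun f _ => by ring

theorem contract_add_right (b c c' : (Fin k → V) → ℝ) :
    contract b (c + c') = contract b c + contract b c' := by
  rw [contract_comm, contract_add_left, contract_comm c, contract_comm c']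

theorem contract_smul_right (r : ℝ) (b c : (Fin k → V) → ℝ) :
    contract b (r • c) = r * contract b c := by
  rw [contract_comm, contract_smul_left, contract_comm c]

theorem contract_self_nonneg (b : (Fin k → V) → ℝ) : 0 ≤ contract b b :=
  mul_nonneg (by positivity) (Finset.sum_nonneg fun f _ => mul_self_nonneg _)

theorem eq_zero_of_contract_self {b : V [⋀^Fin k]→ₗ[ℝ] ℝ} (hb : contract b b = 0) : b = 0 := by
  rw [contract, mul_eq_zero, or_iff_right (by positivity),
    Finset.sum_eq_zero_iff_of_nonneg fun f _ => mul_self_nonneg _] at hb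
  refine Module.Basis.ext_alternating (stdOrthonormalBasis ℝ V).toBasis fun f _ => ?_
  simpa using hb f (Finset.mem_univ f)

theorem contract_reindex {ι : Type*} [Fintype ι] (ε : Fin (Module.finrank ℝ V) ≃ ι)
    (b c : (Fin k → V) → ℝ) :
    contract b c = (k.factorial : ℝ)⁻¹ * ∑ f : Fin k → ι,
      b (fun i => (stdOrthonormalBasis ℝ V).reindex ε (f i)) *
        c (fun i => (stdOrthonormalBasis ℝ V).reindex ε (f i)) := by
  rw [contract]
  congr 1
  refine Fintype.sum_equiv ((Equiv.refl (Fin k)).arrowCongr ε) _ _ fun f => ?_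
  simp

/-- The contraction in an arbitrary basis. -/
theorem contract_eq_sum_basis {κ : Type*} [Fintype κ] [DecidableEq κ] (v : Module.Basis κ ℝ V)
    (b c : MultilinearMap ℝ (fun _ : Fin k => V) ℝ) :
    contract b c = (k.factorial : ℝ)⁻¹ * ∑ f : Fin k → κ, ∑ g : Fin k → κ,
      (∏ i, (gram v)⁻¹ (f i) (g i)) * (b (fun i => v (f i)) * c (fun i => v (g i))) := by
  have hG := Matrix.inv_eq_right_inv (gram_mul_sum_repr (stdOrthonormalBasis ℝ V) v)
  rw [contract]
  set e := stdOrthonormalBasis ℝ V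
  have hexp : ∀ (m : MultilinearMap ℝ (fun _ : Fin k => V) ℝ)
      (p : Fin k → Fin (Module.finrank ℝ V)),
      m (fun i => e (p i)) =
        ∑ f : Fin k → κ, (∏ i, v.repr (e (p i)) (f i)) * m (fun i => v (f i)) := by
    intro m p
    conv_lhs => rw [show (fun i => e (p i)) = fun i => ∑ j, v.repr (e (p i)) j • v j from
      funext fun i => (v.sum_repr _).symm]
    rw [m.map_sum]
    exact Finset.sum_congr rfl fun f _ => by rw [m.map_smul_univ, smul_eq_mul]
  rw [hG]
  congr 1
  simp only [hexp, Matrix.of_apply, Finset.prod_univ_sum, Fintype.piFinset_univ,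
    Finset.sum_mul_sum]
  simp only [Finset.sum_mul, Finset.prod_mul_distrib]
  rw [Finset.sum_comm]
  refine Finset.sum_congr rfl fun f _ => ?_
  rw [Finset.sum_comm]
  exact Finset.sum_congr rfl fun g _ => Finset.sum_congr rfl fun p _ => by ring

variable [Fact (Module.finrank ℝ V = n)] (o : Orientation ℝ V (Fin n))

theorem hodge_apply (h : k + l = n) (b : V [⋀^Fin k]→ₗ[ℝ] ℝ) (w : Fin l → V) :
    hodge o h b w = contract b (fun u => o.volumeForm (concat h u w)) := by
  simp only [hodge, contract, AlternatingMap.smul_apply, alternatingMap_sum_apply, smul_eq_mul]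
  rfl

theorem hodge_smul (h : k + l = n) (r : ℝ) (b : V [⋀^Fin k]→ₗ[ℝ] ℝ) :
    hodge o h (r • b) = r • hodge o h b := by
  ext w
  rw [AlternatingMap.smul_apply, hodge_apply, hodge_apply, smul_eq_mul, ← contract_smul_left]
  rfl

/-- By linearity the Hodge star is a sum of insertions into the volume form, and `wedge_insertLeft`
evaluates each of them. -/
theorem wedge_hodge (h : k + l = n) (a b : V [⋀^Fin k]→ₗ[ℝ] ℝ) :
    wedge h a (hodge o h b) = contract a b • o.volumeForm := by
  simp only [hodge, wedge_smul_right, wedge_sum_right, wedge_insertLeft h Fact.out, smul_smul,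
    ← Finset.sum_smul, contract]
  simp only [mul_comm]

/-- With `A` the matrix of `v` in orthonormal coordinates, the volume is `± det A` and the Gram
matrix is `Aᵀ A`. -/
theorem volumeForm_sq (v : Fin n → V) : o.volumeForm v ^ 2 = (gram v).det := by
  let e := (stdOrthonormalBasis ℝ V).reindex (finCongr (Fact.out : Module.finrank ℝ V = n))
  rw [← sq_abs, o.volumeForm_robust' e, sq_abs, Module.Basis.det_apply, sq]
  nth_rewrite 1 [← Matrix.det_transpose]
  rw [← Matrix.det_mul]
  congr 1
  ext i j
  simp only [Matrix.mul_apply, gram, Matrix.transpose_apply, Module.Basis.toMatrix_apply,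
    Matrix.of_apply, OrthonormalBasis.coe_toBasis_repr_apply, OrthonormalBasis.repr_apply_apply]
  rw [← e.sum_inner_mul_inner]
  exact Finset.sum_congr rfl fun p _ => by rw [real_inner_comm]

/-- Each of the `n!` permutations contributes `1`, which the normalization `1 / n!` cancels. -/
theorem contract_volumeForm_self : contract o.volumeForm o.volumeForm = 1 := by
  rw [contract_reindex (finCongr (Fact.out : Module.finrank ℝ V = n)), alternating_sum_eq_sum_perm]
  set e := (stdOrthonormalBasis ℝ V).reindex (finCongr (Fact.out : Module.finrank ℝ V = n))
  have : ∀ σ : Equiv.Perm (Fin n), ((Equiv.Perm.sign σ : ℤ) : ℝ) * o.volumeForm e *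
      o.volumeForm (fun i => e (σ i)) = 1 := by
    intro σ
    have h1 : o.volumeForm (fun i => e (σ i)) = Equiv.Perm.sign σ • o.volumeForm e :=
      o.volumeForm.map_perm e σ
    have h2 : ((Equiv.Perm.sign σ : ℤ) : ℝ) * ((Equiv.Perm.sign σ : ℤ) : ℝ) = 1 := by
      rw [← Int.cast_mul, ← Units.val_mul, Int.units_mul_self]; simp
    rw [h1, Units.smul_def, zsmul_eq_mul]
    linear_combination h2 * o.volumeForm e * o.volumeForm e + volumeForm_mul_self o e
  simp only [this, Finset.sum_const, Finset.card_univ, Fintype.card_perm, Fintype.card_fin,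
    nsmul_eq_mul, mul_one]
  exact inv_mul_cancel₀ (by positivity)

/-- `a ∧ b = ⟨*a, b⟩ vol`. -/
theorem wedge_eq_contract_hodge (h : k + l = n) (a : V [⋀^Fin k]→ₗ[ℝ] ℝ)
    (b : V [⋀^Fin l]→ₗ[ℝ] ℝ) :
    wedge h a b = contract (hodge o h a) b • o.volumeForm := by
  let e := (stdOrthonormalBasis ℝ V).reindex (finCongr (Fact.out : Module.finrank ℝ V = n))
  let ε := finSumFinEquiv.trans (finCongr h)
  let e' := (stdOrthonormalBasis ℝ V).reindex
    ((finCongr (Fact.out : Module.finrank ℝ V = n)).trans ε.symm)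
  have hee : ∀ s, e (ε s) = e' s := by
    intro s
    simp [e, e', -finSumFinEquiv_apply_left, -finSumFinEquiv_apply_right]
  suffices hs : wedge h a b e = contract (hodge o h a) b * o.volumeForm e by
    rw [(wedge h a b).eq_smul_basis_det e.toBasis,
      (contract (hodge o h a) b • o.volumeForm).eq_smul_basis_det e.toBasis]
    simp [hs]
  have h0 : ((k.factorial : ℝ) * l.factorial) ≠ 0 := by positivity
  refine mul_left_cancel₀ h0 ?_
  let η := o.volumeForm.domDomCongr ε.symm
  have hη : η e' = o.volumeForm e := by
    change o.volumeForm (fun i => e' (ε.symm i)) = _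
    congr 1; funext i
    rw [← hee, Equiv.apply_symm_apply]
  have hηc : ∀ (f : Fin k → Fin k ⊕ Fin l) (g : Fin l → Fin k ⊕ Fin l),
      o.volumeForm (concat h (fun i => e' (f i)) (fun i => e' (g i))) =
        η (fun s => e' (Sum.elim f g s)) := by
    intro f g
    rw [concat_comp]
    rfl
  -- The weight carries an extra `η e'`, whose square is `1`: one copy is produced by the
  -- permutation sum, the other matches the factor `o.volumeForm e` of the goal.
  have hsum := alternating_sum_eq_sum_perm η e' fun g => η e' *
    (a (fun i => e' (g (Sum.inl i))) * b (fun i => e' (g (Sum.inr i))))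
  have hl : (k.factorial * l.factorial : ℝ) * wedge h a b e = ∑ σ : Equiv.Perm (Fin k ⊕ Fin l),
      ((Equiv.Perm.sign σ : ℤ) : ℝ) * η e' * (η e' *
        (a (fun i => e' (σ (Sum.inl i))) * b (fun i => e' (σ (Sum.inr i))))) := by
    rw [factorial_mul_wedge_apply]
    refine Finset.sum_congr rfl fun σ _ => ?_
    have := volumeForm_mul_self o e
    rw [hη]
    simp only [← hee]
    change _ = _ * (_ * (a (fun i => e (finCongr h (finSumFinEquiv (σ (Sum.inl i))))) *
      b (fun i => e (finCongr h (finSumFinEquiv (σ (Sum.inr i)))))))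
    linear_combination (-((Equiv.Perm.sign σ : ℤ) : ℝ) *
      (a (fun i => e (finCongr h (finSumFinEquiv (σ (Sum.inl i))))) *
      b (fun i => e (finCongr h (finSumFinEquiv (σ (Sum.inr i))))))) * this
  rw [hl, ← hsum, contract_reindex ((finCongr (Fact.out : Module.finrank ℝ V = n)).trans ε.symm)]
  simp only [hodge_apply,
    contract_reindex ((finCongr (Fact.out : Module.finrank ℝ V = n)).trans ε.symm)]
  change _ = _ * ((_ * ∑ g : Fin l → Fin k ⊕ Fin l, (_ * ∑ f : Fin k → Fin k ⊕ Fin l,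
    a (fun i => e' (f i)) * o.volumeForm (concat h (fun i => e' (f i)) (fun i => e' (g i)))) *
      b (fun i => e' (g i))) * _)
  simp only [hηc]
  have hk : (k.factorial : ℝ) ≠ 0 := by positivity
  have hl' : (l.factorial : ℝ) ≠ 0 := by positivity
  -- An index map on `Fin k ⊕ Fin l` is a pair of index maps, so the sum splits into the two nested
  -- sums of the contraction and the Hodge star.
  rw [Fintype.sum_equiv (Equiv.sumArrowEquivProdArrow (Fin k) (Fin l) (Fin k ⊕ Fin l)) _
    (fun q => η (fun s => e' (Sum.elim q.1 q.2 s)) *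
      (η e' * (a (fun i => e' (q.1 i)) * b (fun i => e' (q.2 i))))) ?_, Fintype.sum_prod_type_right]
  · rw [← hη]
    simp only [Finset.sum_mul, Finset.mul_sum]
    exact Finset.sum_congr rfl fun _ _ => Finset.sum_congr rfl fun _ _ => by field_simp
  · intro q
    congr 3
    funext s
    rcases s with s | s <;> rfl

theorem volumeForm_ne_zero : o.volumeForm ≠ 0 := by
  intro h
  have := contract_volumeForm_self o
  rw [h] at this
  simp [contract] at this

/-- By nondegeneracy: for every `(n-1)`-form `δ`, both `δ ∧ **a` and `(-1)^(n-1) δ ∧ a = a ∧ δ`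
equal `⟨δ, *a⟩ vol`. Hence the difference `c` satisfies `δ ∧ c = 0`, and `δ = *c` gives `⟨c, c⟩ =
0`. -/
theorem hodge_hodge_one (h : (n - 1) + 1 = n) (h' : 1 + (n - 1) = n) (a : V [⋀^Fin 1]→ₗ[ℝ] ℝ) :
    hodge o h (hodge o h' a) = (-1 : ℝ) ^ (n - 1) • a := by
  rw [← sub_eq_zero]
  set c := hodge o h (hodge o h' a) - (-1 : ℝ) ^ (n - 1) • a with hc
  refine eq_zero_of_contract_self ?_
  have h1 : ∀ δ, wedge h δ c = 0 := by
    intro δ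
    rw [hc, wedge_sub_right, wedge_hodge, wedge_smul_right, ← wedge_comm_one h h',
      wedge_eq_contract_hodge o h', contract_comm, sub_self]
  have h2 := wedge_hodge o h' c c
  rw [wedge_comm_one h h', h1, smul_zero, eq_comm, smul_eq_zero,
    or_iff_left (volumeForm_ne_zero o)] at h2
  exact h2

/-- Wedging `a - b` with `*a = *b` gives `⟨a - b, a⟩ = ⟨a - b, b⟩`, and the inner product is
definite. -/
theorem hodge_injective (h : k + l = n) {a b : V [⋀^Fin k]→ₗ[ℝ] ℝ}
    (hab : hodge o h a = hodge o h b) : a = b := by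
  rw [← sub_eq_zero]
  refine eq_zero_of_contract_self ?_
  have h1 := wedge_hodge o h (a - b) a
  rw [hab, wedge_hodge] at h1
  have h2 := smul_left_injective ℝ (volumeForm_ne_zero o) h1
  have h3 : (⇑(a - b) : (Fin k → V) → ℝ) = ⇑a + (-1 : ℝ) • ⇑b := by
    funext v; simp [sub_eq_add_neg]
  rw [show contract ⇑(a - b) ⇑(a - b) = contract ⇑(a - b) (⇑a + (-1 : ℝ) • ⇑b) by rw [← h3],
    contract_add_right, contract_smul_right, h2]
  ring

theorem eq_density_smul (h : n + 0 = n) (η : V [⋀^Fin n]→ₗ[ℝ] ℝ) :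
    η = hodge o h η Fin.elim0 • o.volumeForm := by
  have h1 : hodge o h η Fin.elim0 = contract η o.volumeForm := by
    rw [hodge_apply]
    congr 1
    funext u
    congr 1
    funext i
    exact concat_apply h u Fin.elim0 (Sum.inl i)
  let e := (stdOrthonormalBasis ℝ V).reindex (finCongr (Fact.out : Module.finrank ℝ V = n))
  have h2 : η = (η e * o.volumeForm e) • o.volumeForm := by
    conv_lhs => rw [η.eq_smul_basis_det e.toBasis]
    have h3 := o.volumeForm.eq_smul_basis_det e.toBasis
    rw [OrthonormalBasis.coe_toBasis] at h3 ⊢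
    nth_rewrite 2 [h3]
    rw [smul_smul, mul_assoc, volumeForm_mul_self, mul_one]
  rw [h1]
  conv_lhs => rw [h2]
  conv_rhs => rw [h2]
  rw [show ⇑((η e * o.volumeForm e) • o.volumeForm) =
    (η e * o.volumeForm e) • ⇑o.volumeForm from rfl, contract_smul_left,
    contract_volumeForm_self, mul_one]

theorem contract_one_self (a : V [⋀^Fin 1]→ₗ[ℝ] ℝ) (w : Fin 0 → V) :
    a.curryLeft (sharp a) w = contract a a := by
  have h1 : ∀ v : Fin 1 → V, a v = inner ℝ (sharp a) (v 0) := by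
    intro v
    rw [sharp, InnerProductSpace.toDual_symm_apply]
    change a v = a (fun _ => v 0)
    congr 1; funext i; rw [Subsingleton.elim i 0]
  rw [AlternatingMap.curryLeft_apply_apply, h1, Matrix.cons_val_zero, contract, Nat.factorial_one,
    Nat.cast_one, inv_one, one_mul,
    Fintype.sum_equiv (Equiv.funUnique (Fin 1) _) _ (fun p =>
      inner ℝ (sharp a) (stdOrthonormalBasis ℝ V p) * inner ℝ (stdOrthonormalBasis ℝ V p) (sharp a))
      (fun f => by rw [h1, real_inner_comm (sharp a) (stdOrthonormalBasis ℝ V _)]; rfl),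
    (stdOrthonormalBasis ℝ V).sum_inner_mul_inner]

theorem wedge_zero_left (h : 0 + n = n) (f : V [⋀^Fin 0]→ₗ[ℝ] ℝ) (η : V [⋀^Fin n]→ₗ[ℝ] ℝ) :
    wedge h f η = f Fin.elim0 • η := by
  have h1 : insertLeft h η Fin.elim0 = η := by
    ext w
    change η (concat h _ w) = _
    congr 1; funext i
    obtain ⟨s, rfl⟩ := (finSumFinEquiv.trans (finCongr h)).surjective i
    rcases s with s | s
    · exact s.elim0
    · rw [Equiv.trans_apply, concat_apply, Sum.elim_inr]
      congr 1
      ext; simp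
  conv_lhs => rw [← h1, wedge_insertLeft h (Fact.out : Module.finrank ℝ V = n)]

end Contract

/-! ### Coordinate frames and smoothness in charts. -/

section Charts

variable {n : ℕ} {H : Type*} [TopologicalSpace H]
  {I : ModelWithCorners ℝ (EuclideanSpace ℝ (Fin n)) H}
  {M : Type*} [TopologicalSpace M] [ChartedSpace H M]

/-- The coordinate frame of the chart around `x₀` at the point with coordinates `y`. -/
noncomputable def chartFrame (I : ModelWithCorners ℝ (EuclideanSpace ℝ (Fin n)) H) (x₀ : M)
    (y : EuclideanSpace ℝ (Fin n)) (i : Fin n) : TangentSpace I ((extChartAt I x₀).symm y) :=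
  mfderivWithin 𝓘(ℝ, EuclideanSpace ℝ (Fin n)) I (extChartAt I x₀).symm (range I) y (stdFrame n i)

theorem exists_basis_chartFrame [IsManifold I 1 M] {x₀ : M} {y : EuclideanSpace ℝ (Fin n)}
    (hy : y ∈ (extChartAt I x₀).target) :
    ∃ v : Module.Basis (Fin n) ℝ (TangentSpace I ((extChartAt I x₀).symm y)),
      ⇑v = chartFrame I x₀ y := by
  obtain ⟨D, hD⟩ := isInvertible_mfderivWithin_extChartAt_symm (I := I) hy
  let D' : EuclideanSpace ℝ (Fin n) ≃ₗ[ℝ] TangentSpace I ((extChartAt I x₀).symm y) :=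
    D.toLinearEquiv
  refine ⟨(EuclideanSpace.basisFun (Fin n) ℝ).toBasis.map D', ?_⟩
  funext i
  rw [Module.Basis.map_apply, OrthonormalBasis.coe_toBasis, EuclideanSpace.basisFun_apply,
    chartFrame, ← hD]
  rfl

/-- Smoothness of a function in charts. -/
def IsSmoothFun (I : ModelWithCorners ℝ (EuclideanSpace ℝ (Fin n)) H) (f : M → ℝ) : Prop :=
  ∀ x₀ : M, ContDiffOn ℝ ∞ (fun y => f ((extChartAt I x₀).symm y)) (extChartAt I x₀).target

theorem IsSmoothFun.continuous {f : M → ℝ} (hf : IsSmoothFun I f) : Continuous f := by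
  rw [continuous_iff_continuousAt]
  intro x
  have h1 : ContinuousOn (fun z => f ((extChartAt I x).symm (extChartAt I x z)))
      (extChartAt I x).source :=
    (hf x).continuousOn.comp (continuousOn_extChartAt x) (extChartAt I x).mapsTo
  refine ((h1.congr fun z hz => ?_).continuousAt
    ((isOpen_extChartAt_source x).mem_nhds (mem_extChartAt_source x)))
  rw [(extChartAt I x).left_inv hz]

theorem IsSmoothForm.smul {k : ℕ} {f : M → ℝ} (hf : IsSmoothFun I f) {η : DiffForm I M k}
    (hη : IsSmoothForm η) : IsSmoothForm (fun x => f x • η x) :=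
  fun x₀ v => (hf x₀).mul (hη x₀ v)

theorem IsSmoothForm.sub {k : ℕ} {η θ : DiffForm I M k}
    (hη : IsSmoothForm η) (hθ : IsSmoothForm θ) : IsSmoothForm (η - θ) :=
  fun x₀ v => (hη x₀ v).sub (hθ x₀ v)

variable [RiemannianBundle (fun x : M => TangentSpace I x)]

/-- The coordinate frame is the local frame of the tangent bundle trivialization at `x₀`, so
smoothness of the metric applies to it. -/
theorem contDiffOn_inner_chartFrame [IsManifold I ∞ M]
    [IsContMDiffRiemannianBundle I ∞ (EuclideanSpace ℝ (Fin n)) (fun x : M => TangentSpace I x)]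
    (x₀ : M) (i j : Fin n) :
    ContDiffOn ℝ ∞ (fun y => inner ℝ (chartFrame I x₀ y i) (chartFrame I x₀ y j))
      (extChartAt I x₀).target := by
  have : IsManifold I 1 M := IsManifold.of_le (n := ∞) (by exact_mod_cast le_top)
  let b := (EuclideanSpace.basisFun (Fin n) ℝ).toBasis
  let e := trivializationAt (EuclideanSpace ℝ (Fin n)) (TangentSpace I) x₀
  have h1 := fun i => e.contMDiffOn_localFrame_baseSet (I := I) (n := ∞) b i
  have h2 := ContMDiffOn.inner_bundle (h1 i) (h1 j)
  have h3 := h2.comp (contMDiffOn_extChartAt_symm (I := I) (n := ∞) x₀) (fun y hy => by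
    have := (extChartAt I x₀).map_target hy
    rw [extChartAt_source] at this
    simpa [e] using this)
  rw [contMDiffOn_iff_contDiffOn] at h3
  refine h3.congr fun y hy => ?_
  have hx : (extChartAt I x₀).symm y ∈ (chartAt H x₀).source := by
    have := (extChartAt I x₀).map_target hy
    rwa [extChartAt_source] at this
  have key : ∀ i, e.localFrame b i ((extChartAt I x₀).symm y) = chartFrame I x₀ y i := by
    intro i
    have hb : (extChartAt I x₀).symm y ∈ e.baseSet := by simpa [e] using hx
    rw [e.localFrame_apply_of_mem_baseSet b hb]
    have := TangentBundle.symmL_trivializationAt (I := I) hx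
    rw [(extChartAt I x₀).right_inv hy] at this
    rw [chartFrame, ← this]
    have hbi : b i = stdFrame n i := by simp [b, stdFrame]
    rw [← hbi]
    exact (Module.Basis.map_apply _ _ _).trans (Trivialization.symmL_apply (hb := hb) ..).symm
  simp only [Function.comp_apply, key]


theorem contDiffOn_det {E : Type*} [NormedAddCommGroup E] [NormedSpace ℝ E] {ι : Type*} [Fintype ι]
    [DecidableEq ι] {A : E → Matrix ι ι ℝ} {s : Set E}
    (hA : ∀ i j, ContDiffOn ℝ ∞ (fun y => A y i j) s) : ContDiffOn ℝ ∞ (fun y => (A y).det) s := by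
  simp only [Matrix.det_apply']
  exact ContDiffOn.sum fun σ _ => contDiffOn_const.mul (contDiffOn_prod fun i _ => hA _ _)

theorem contDiffOn_matrix_inv {E : Type*} [NormedAddCommGroup E] [NormedSpace ℝ E] {ι : Type*}
    [Fintype ι] [DecidableEq ι] {A : E → Matrix ι ι ℝ} {s : Set E}
    (hA : ∀ i j, ContDiffOn ℝ ∞ (fun y => A y i j) s) (h0 : ∀ y ∈ s, (A y).det ≠ 0) (i j : ι) :
    ContDiffOn ℝ ∞ (fun y => (A y)⁻¹ i j) s := by
  simp only [Matrix.inv_def, Matrix.smul_apply, Ring.inverse_eq_inv', smul_eq_mul,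
    Matrix.adjugate_apply]
  refine ((contDiffOn_det hA).inv h0).mul (contDiffOn_det fun p q => ?_)
  simp only [Matrix.updateRow_apply]
  split_ifs
  · exact contDiffOn_const
  · exact hA p q

theorem det_gram_ne_zero {V : Type*} [NormedAddCommGroup V] [InnerProductSpace ℝ V]
    [FiniteDimensional ℝ V] {κ : Type*} [Fintype κ] [DecidableEq κ] (v : Module.Basis κ ℝ V) :
    (gram v).det ≠ 0 := by
  have := congrArg Matrix.det (gram_mul_sum_repr (stdOrthonormalBasis ℝ V) v)
  rw [Matrix.det_mul, Matrix.det_one] at this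
  exact left_ne_zero_of_mul_eq_one this

/-! ### Smoothness of contractions. -/

section Smooth

variable [IsManifold I ∞ M]

theorem det_gram_chartFrame_ne_zero (x₀ : M) {y : EuclideanSpace ℝ (Fin n)}
    (hy : y ∈ (extChartAt I x₀).target) : (gram (chartFrame I x₀ y)).det ≠ 0 := by
  have : IsManifold I 1 M := IsManifold.of_le (n := ∞) (by exact_mod_cast le_top)
  obtain ⟨v, hv⟩ := exists_basis_chartFrame (I := I) hy
  rw [← hv]
  exact det_gram_ne_zero v

variable
    [IsContMDiffRiemannianBundle I ∞ (EuclideanSpace ℝ (Fin n)) (fun x : M => TangentSpace I x)]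

/-- A contraction of multilinear forms with smooth components is smooth. -/
theorem contDiffOn_contract {k : ℕ} (x₀ : M)
    (b c : ∀ y : EuclideanSpace ℝ (Fin n), MultilinearMap ℝ
      (fun _ : Fin k => TangentSpace I ((extChartAt I x₀).symm y)) ℝ)
    (hb : ∀ f : Fin k → Fin n, ContDiffOn ℝ ∞ (fun y => b y (fun i => chartFrame I x₀ y (f i)))
      (extChartAt I x₀).target)
    (hc : ∀ f : Fin k → Fin n, ContDiffOn ℝ ∞ (fun y => c y (fun i => chartFrame I x₀ y (f i)))
      (extChartAt I x₀).target) :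
    ContDiffOn ℝ ∞ (fun y => contract (b y) (c y)) (extChartAt I x₀).target := by
  have : IsManifold I 1 M := IsManifold.of_le (n := ∞) (by exact_mod_cast le_top)
  have h : ContDiffOn ℝ ∞ (fun y => (k.factorial : ℝ)⁻¹ * ∑ f : Fin k → Fin n, ∑ g : Fin k → Fin n,
      (∏ i, (gram (chartFrame I x₀ y))⁻¹ (f i) (g i)) *
        (b y (fun i => chartFrame I x₀ y (f i)) * c y (fun i => chartFrame I x₀ y (g i))))
      (extChartAt I x₀).target := by
    refine contDiffOn_const.mul (ContDiffOn.sum fun f _ => ContDiffOn.sum fun g _ => ?_)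
    refine (contDiffOn_prod fun i _ => ?_).mul ((hb f).mul (hc g))
    exact contDiffOn_matrix_inv (fun p q => contDiffOn_inner_chartFrame x₀ p q)
      (fun y hy => det_gram_chartFrame_ne_zero x₀ hy) _ _
  refine h.congr fun y hy => ?_
  obtain ⟨v, hv⟩ := exists_basis_chartFrame (I := I) hy
  simp only [← hv]
  exact contract_eq_sum_basis v (b y) (c y)

end Smooth

/-! ### The volume form and smoothness of the Hodge star. -/

section VolForm

/-- The Riemannian volume form. -/
noncomputable def volForm (o : ManifoldOrientation I M) : DiffForm I M n :=
  fun x => (o.orient x).volumeForm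

theorem chartSign_eq (hn : 1 ≤ n) (o : ManifoldOrientation I M) (x₀ : M)
    (y : EuclideanSpace ℝ (Fin n)) :
    chartSign o.orient x₀ y = SignType.sign (chartPullback x₀ (volForm o) y (stdFrame n)) := by
  obtain ⟨c, hc, h⟩ := exists_someVector_eq_smul_volumeForm
    (o.orient ((extChartAt I x₀).symm y)) hn
  change ((SignType.sign ((o.orient ((extChartAt I x₀).symm y)).someVector
    (chartFrame I x₀ y)) : SignType) : ℝ) = SignType.sign
      ((o.orient ((extChartAt I x₀).symm y)).volumeForm (chartFrame I x₀ y))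
  rw [h, AlternatingMap.smul_apply, smul_eq_mul, sign_mul, sign_pos hc, one_mul]

theorem chartPullback_volForm_sq (o : ManifoldOrientation I M) (x₀ : M)
    (y : EuclideanSpace ℝ (Fin n)) :
    chartPullback x₀ (volForm o) y (stdFrame n) ^ 2 = (gram (chartFrame I x₀ y)).det :=
  volumeForm_sq (o.orient ((extChartAt I x₀).symm y)) (chartFrame I x₀ y)

/-- Sign times value is the absolute value. Thus the orientation drops out of integrals against the
volume form, leaving the positive density `√det g`. -/
theorem chartSign_mul_chartPullback_volForm (hn : 1 ≤ n) (o : ManifoldOrientation I M) (x₀ : M)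
    (y : EuclideanSpace ℝ (Fin n)) :
    chartSign o.orient x₀ y * chartPullback x₀ (volForm o) y (stdFrame n) =
      √(gram (chartFrame I x₀ y)).det := by
  rw [chartSign_eq hn, ← chartPullback_volForm_sq o, Real.sqrt_sq_eq_abs, sign_mul_self]

theorem contDiffOn_of_continuousOn_of_sq_eq_one {E : Type*} [NormedAddCommGroup E]
    [NormedSpace ℝ E] {f : E → ℝ} {s : Set E} (hf : ContinuousOn f s)
    (h1 : ∀ y ∈ s, f y = 1 ∨ f y = -1) : ContDiffOn ℝ ∞ f s := by
  intro y hy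
  refine (contDiffWithinAt_const (c := f y)).congr_of_eventuallyEq ?_ rfl
  filter_upwards [(hf y hy).eventually (Metric.ball_mem_nhds (f y) one_pos), self_mem_nhdsWithin]
    with z hz hzs
  rw [Real.dist_eq, abs_lt] at hz
  rcases h1 y hy with h | h <;> rcases h1 z hzs with h' | h' <;> rw [h, h'] at hz ⊢ <;> linarith

variable [IsManifold I ∞ M]

theorem chartPullback_volForm_ne_zero (o : ManifoldOrientation I M) (x₀ : M)
    {y : EuclideanSpace ℝ (Fin n)} (hy : y ∈ (extChartAt I x₀).target) :
    chartPullback x₀ (volForm o) y (stdFrame n) ≠ 0 := by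
  have := det_gram_chartFrame_ne_zero x₀ hy
  rw [← chartPullback_volForm_sq o] at this
  exact fun h => this (by rw [h]; ring)

theorem chartSign_eq_or (hn : 1 ≤ n) (o : ManifoldOrientation I M) (x₀ : M)
    {y : EuclideanSpace ℝ (Fin n)} (hy : y ∈ (extChartAt I x₀).target) :
    chartSign o.orient x₀ y = 1 ∨ chartSign o.orient x₀ y = -1 := by
  rw [chartSign_eq hn]
  rcases lt_or_gt_of_ne (chartPullback_volForm_ne_zero o x₀ hy) with h | h
  · right; rw [sign_neg h]; simp
  · left; rw [sign_pos h]; simp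

variable
    [IsContMDiffRiemannianBundle I ∞ (EuclideanSpace ℝ (Fin n)) (fun x : M => TangentSpace I x)]

theorem isSmoothForm_volForm (hn : 1 ≤ n) (o : ManifoldOrientation I M) :
    IsSmoothForm (volForm o) := by
  intro x₀ v
  have h1 : ContDiffOn ℝ ∞ (fun y => chartPullback x₀ (volForm o) y (stdFrame n))
      (extChartAt I x₀).target := by
    have hs := contDiffOn_of_continuousOn_of_sq_eq_one (o.continuousOn_chartSign x₀)
      fun y hy => chartSign_eq_or hn o x₀ hy
    -- Since the sign squares to `1`, the coordinate volume is the sign times `√det g`; the sign is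
    -- continuous with values `±1`, hence locally constant.
    refine (hs.mul ((contDiffOn_det fun p q => contDiffOn_inner_chartFrame x₀ p q).sqrt
      fun y hy => det_gram_chartFrame_ne_zero x₀ hy)).congr fun y hy => ?_
    have h := chartSign_mul_chartPullback_volForm hn o x₀ y
    change _ = _ * √(gram (chartFrame I x₀ y)).det
    rw [← h]
    rcases chartSign_eq_or hn o x₀ hy with h' | h' <;> rw [h'] <;> ring
  refine (h1.mul (contDiffOn_const
    (c := (EuclideanSpace.basisFun (Fin n) ℝ).toBasis.det v))).congr fun y _ => ?_
  have h2 := (chartPullback x₀ (volForm o) y).eq_smul_basis_det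
    (EuclideanSpace.basisFun (Fin n) ℝ).toBasis
  have h3 : ⇑(EuclideanSpace.basisFun (Fin n) ℝ).toBasis = stdFrame n := by
    funext i; simp [stdFrame]
  rw [h3] at h2
  exact congrArg (fun η => η v) h2

theorem concat_update_left {V : Type*} {k l n : ℕ} [DecidableEq (Fin k)] (h : k + l = n)
    (u : Fin k → V) (w : Fin l → V) (i : Fin k) (z : V) :
    concat h (Function.update u i z) w =
      Function.update (concat h u w) (finCongr h (finSumFinEquiv (Sum.inl i))) z := by
  funext j
  obtain ⟨s, rfl⟩ := (finSumFinEquiv.trans (finCongr h)).surjective j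
  rw [Equiv.trans_apply, concat_apply]
  by_cases hs : s = Sum.inl i
  · subst hs; simp [-finSumFinEquiv_apply_left]
  · have : finCongr h (finSumFinEquiv s) ≠ finCongr h (finSumFinEquiv (Sum.inl i)) := fun hc =>
      hs (finSumFinEquiv.injective ((finCongr h).injective hc))
    rw [Function.update_of_ne this, concat_apply]
    rcases s with s | s
    · have : s ≠ i := fun hc => hs (by rw [hc])
      simp [Function.update_of_ne this]
    · rfl

/-- The multilinear map `u ↦ η (u₁, …, u_k, w₁, …, w_l)`. -/
def insertRight {V : Type*} [AddCommGroup V] [Module ℝ V] {k l n : ℕ} (h : k + l = n)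
    (η : V [⋀^Fin n]→ₗ[ℝ] ℝ) (w : Fin l → V) : MultilinearMap ℝ (fun _ : Fin k => V) ℝ where
  toFun u := η (concat h u w)
  map_update_add' u i x y := by simp only [concat_update_left, η.map_update_add]
  map_update_smul' u i c x := by simp only [concat_update_left, η.map_update_smul]

/-- A component of `*η` is the contraction of `η` with the volume form whose last slots hold fixed
coordinate vectors; both have smooth components. -/
theorem isSmoothForm_hodgeStar (hn : 1 ≤ n) {k l : ℕ} (h : k + l = n) (o : ManifoldOrientation I M)
    {η : DiffForm I M k} (hη : IsSmoothForm η) : IsSmoothForm (hodgeStar o h η) := by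
  intro x₀ w
  let D := fun y => mfderivWithin 𝓘(ℝ, EuclideanSpace ℝ (Fin n)) I (extChartAt I x₀).symm
    (range I) y
  refine (contDiffOn_contract x₀ (fun y => (η ((extChartAt I x₀).symm y)).toMultilinearMap)
    (fun y => insertRight h (volForm o ((extChartAt I x₀).symm y)) (fun i => D y (w i)))
    (fun f => hη x₀ fun i => stdFrame n (f i)) fun f => ?_).congr fun y _ => ?_
  · refine (isSmoothForm_volForm hn o x₀ (concat h (fun i => stdFrame n (f i)) w)).congr
      fun y _ => ?_
    exact congrArg (volForm o ((extChartAt I x₀).symm y))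
      (concat_comp h (fun i => stdFrame n (f i)) w (D y))
  · exact hodge_apply (o.orient ((extChartAt I x₀).symm y)) h (η ((extChartAt I x₀).symm y))
      (fun i => D y (w i))

end VolForm

theorem isSmoothFun_contract [IsManifold I ∞ M]
    [IsContMDiffRiemannianBundle I ∞ (EuclideanSpace ℝ (Fin n)) (fun x : M => TangentSpace I x)]
    {k : ℕ} {η θ : DiffForm I M k} (hη : IsSmoothForm η) (hθ : IsSmoothForm θ) :
    IsSmoothFun I (fun x => contract (η x) (θ x)) :=
  fun x₀ => contDiffOn_contract x₀ (fun y => (η ((extChartAt I x₀).symm y)).toMultilinearMap)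
    (fun y => (θ ((extChartAt I x₀).symm y)).toMultilinearMap)
    (fun f => hη x₀ fun i => stdFrame n (f i)) (fun f => hθ x₀ fun i => stdFrame n (f i))

theorem isSmoothFun_density [IsManifold I ∞ M]
    [IsContMDiffRiemannianBundle I ∞ (EuclideanSpace ℝ (Fin n)) (fun x : M => TangentSpace I x)]
    (hn : 1 ≤ n) (o : ManifoldOrientation I M) {μ : DiffForm I M n} (hμ : IsSmoothForm μ) :
    IsSmoothFun I (density o μ) := by
  intro x₀
  refine (isSmoothForm_hodgeStar hn (Nat.add_zero n) o hμ x₀ Fin.elim0).congr fun y _ => ?_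
  exact congrArg (hodgeStar o (Nat.add_zero n) μ ((extChartAt I x₀).symm y))
    (Subsingleton.elim _ _)

end Charts

/-! ### Integration against the volume form. -/

section VolIntegral

variable {n : ℕ} {H : Type*} [TopologicalSpace H]
  {I : ModelWithCorners ℝ (EuclideanSpace ℝ (Fin n)) H}
  {M : Type*} [TopologicalSpace M] [ChartedSpace H M]

theorem measurableSet_extChartAt_target (x₀ : M) : MeasurableSet (extChartAt I x₀).target := by
  rw [extChartAt_target]
  exact (((chartAt H x₀).open_target.preimage I.continuous_symm).measurableSet).inter
    I.isClosed_range.measurableSet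

/-- A nonempty relatively open subset of the target of a chart has positive volume. -/
theorem volume_inter_target_pos (x₀ : M) {U : Set (EuclideanSpace ℝ (Fin n))} (hU : IsOpen U)
    (h : (U ∩ (extChartAt I x₀).target).Nonempty) :
    0 < volume (U ∩ (extChartAt I x₀).target) := by
  obtain ⟨y, hyU, hy⟩ := h
  rw [extChartAt_target] at hy ⊢
  have hW : IsOpen (U ∩ I.symm ⁻¹' (chartAt H x₀).target) :=
    hU.inter ((chartAt H x₀).open_target.preimage I.continuous_symm)
  -- The range of a model with corners lies in the closure of its interior, so even near a boundary
  -- point the set contains a nonempty open piece.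
  have hcl := I.range_subset_closure_interior hy.2
  obtain ⟨z, hz, hzi⟩ := mem_closure_iff.1 hcl _ hW ⟨hyU, hy.1⟩
  refine ((hW.inter isOpen_interior).measure_pos volume ⟨z, hz, hzi⟩).trans_le (measure_mono ?_)
  rintro w ⟨⟨h1, h2⟩, h3⟩
  exact ⟨h1, h2, interior_subset h3⟩

theorem continuousOn_mul_sqrt_det_gram [IsManifold I ∞ M]
    [RiemannianBundle (fun x : M => TangentSpace I x)]
    [IsContMDiffRiemannianBundle I ∞ (EuclideanSpace ℝ (Fin n)) (fun x : M => TangentSpace I x)]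
    {f : M → ℝ} (hf : Continuous f) (x₀ : M) :
    ContinuousOn (fun y => f ((extChartAt I x₀).symm y) * √(gram (chartFrame I x₀ y)).det)
      (extChartAt I x₀).target :=
  (hf.comp_continuousOn (continuousOn_extChartAt_symm x₀)).mul
    (contDiffOn_det fun p q => contDiffOn_inner_chartFrame x₀ p q).continuousOn.sqrt

variable [IsManifold I ∞ M] [CompactSpace M] [T2Space M]

/-- A locally finite family on a compact space has finitely many nonzero members; the `finsum`
defining the integral is therefore a genuine finite sum. -/
theorem finite_partitionOfUnity_ne_zero : {x₀ : M | partitionOfUnity I M x₀ ≠ 0}.Finite := by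
  refine (partitionOfUnity I M).locallyFinite.finite_nonempty_of_compact.subset fun x₀ hx => ?_
  by_contra hne
  rw [mem_ofPred_eq, not_nonempty_iff_eq_empty, Function.support_eq_empty_iff] at hne
  exact hx (ContMDiffMap.ext fun x => congrFun hne x)

theorem tsupport_partitionOfUnity_subset (x₀ : M) :
    tsupport (partitionOfUnity I M x₀) ⊆ (extChartAt I x₀).source := by
  rw [extChartAt_source]
  exact (SmoothPartitionOfUnity.exists_isSubordinate_chartAt_source I M).choose_spec x₀

/-- `g` may be unbounded on the chart target, but the cutoff vanishes outside a compact subset of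
it. -/
theorem integrableOn_partitionOfUnity_mul (x₀ : M) {g : EuclideanSpace ℝ (Fin n) → ℝ}
    (hg : ContinuousOn g (extChartAt I x₀).target) :
    IntegrableOn (fun y => partitionOfUnity I M x₀ ((extChartAt I x₀).symm y) * g y)
      (extChartAt I x₀).target := by
  let K := extChartAt I x₀ '' tsupport (partitionOfUnity I M x₀)
  have hsub := tsupport_partitionOfUnity_subset (I := I) x₀
  have hK : IsCompact K := ((isClosed_tsupport _).isCompact).image_of_continuousOn
    ((continuousOn_extChartAt x₀).mono hsub)
  have hKt : K ⊆ (extChartAt I x₀).target := by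
    rintro _ ⟨x, hx, rfl⟩
    exact (extChartAt I x₀).map_source (hsub hx)
  have hc : ContinuousOn (fun y => partitionOfUnity I M x₀ ((extChartAt I x₀).symm y) * g y)
      (extChartAt I x₀).target :=
    ((partitionOfUnity I M x₀).contMDiff.continuous.comp_continuousOn
      (continuousOn_extChartAt_symm x₀)).mul hg
  refine ((hc.mono hKt).integrableOn_compact hK).of_forall_sdiff_eq_zero
    (measurableSet_extChartAt_target x₀) fun y hy => ?_
  have : (extChartAt I x₀).symm y ∉ tsupport (partitionOfUnity I M x₀) := fun h =>
    hy.2 ⟨_, h, (extChartAt I x₀).right_inv hy.1⟩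
  rw [image_eq_zero_of_notMem_tsupport this, zero_mul]

variable [RiemannianBundle (fun x : M => TangentSpace I x)]

/-- The integral of a function against the Riemannian volume form. -/
noncomputable def volIntegral (o : ManifoldOrientation I M) (f : M → ℝ) : ℝ :=
  formIntegral o fun x => f x • volForm o x

theorem volIntegral_eq_sum (hn : 1 ≤ n) (o : ManifoldOrientation I M) (f : M → ℝ) :
    volIntegral o f = ∑ x₀ ∈ (finite_partitionOfUnity_ne_zero (I := I) (M := M)).toFinset,
      ∫ y in (extChartAt I x₀).target, partitionOfUnity I M x₀ ((extChartAt I x₀).symm y) *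
        (f ((extChartAt I x₀).symm y) * √(gram (chartFrame I x₀ y)).det) := by
  rw [volIntegral, formIntegral, finsum_eq_sum_of_support_subset]
  · refine Finset.sum_congr rfl fun x₀ _ => ?_
    congr 1
    funext y
    rw [← chartSign_mul_chartPullback_volForm hn o]
    change _ * _ * (f _ * chartPullback x₀ (volForm o) y (stdFrame n)) = _
    ring
  · intro x₀ hx
    rw [Finite.coe_toFinset]
    intro h0
    refine hx ?_
    simp [h0]

theorem volIntegral_const_mul (hn : 1 ≤ n) (o : ManifoldOrientation I M) (c : ℝ) (f : M → ℝ) :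
    volIntegral o (fun x => c * f x) = c * volIntegral o f := by
  simp only [volIntegral_eq_sum hn, Finset.mul_sum, ← integral_const_mul]
  refine Finset.sum_congr rfl fun x₀ _ => ?_
  congr 1
  funext y
  ring

variable
    [IsContMDiffRiemannianBundle I ∞ (EuclideanSpace ℝ (Fin n)) (fun x : M => TangentSpace I x)]

theorem volIntegral_add (hn : 1 ≤ n) (o : ManifoldOrientation I M) {f g : M → ℝ}
    (hf : Continuous f) (hg : Continuous g) :
    volIntegral o (fun x => f x + g x) = volIntegral o f + volIntegral o g := by
  simp only [volIntegral_eq_sum hn, ← Finset.sum_add_distrib]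
  refine Finset.sum_congr rfl fun x₀ _ => ?_
  rw [← integral_add
    (integrableOn_partitionOfUnity_mul x₀ (continuousOn_mul_sqrt_det_gram (I := I) hf x₀))
    (integrableOn_partitionOfUnity_mul x₀ (continuousOn_mul_sqrt_det_gram (I := I) hg x₀))]
  congr 1
  funext y
  ring

theorem volIntegral_mono (hn : 1 ≤ n) (o : ManifoldOrientation I M) {f g : M → ℝ}
    (hf : Continuous f) (hg : Continuous g) (h : ∀ x, f x ≤ g x) :
    volIntegral o f ≤ volIntegral o g := by
  simp only [volIntegral_eq_sum hn]
  refine Finset.sum_le_sum fun x₀ _ => integral_mono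
    (integrableOn_partitionOfUnity_mul x₀ (continuousOn_mul_sqrt_det_gram (I := I) hf x₀))
    (integrableOn_partitionOfUnity_mul x₀ (continuousOn_mul_sqrt_det_gram (I := I) hg x₀))
    fun y => ?_
  exact mul_le_mul_of_nonneg_left (mul_le_mul_of_nonneg_right (h _) (Real.sqrt_nonneg _))
    ((partitionOfUnity I M).nonneg _ _)

theorem eq_zero_of_volIntegral_eq_zero (hn : 1 ≤ n) (o : ManifoldOrientation I M) {f : M → ℝ}
    (hf : Continuous f) (h0 : ∀ x, 0 ≤ f x) (h : volIntegral o f = 0) (x : M) : f x = 0 := by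
  by_contra hne
  have hpos : 0 < f x := lt_of_le_of_ne (h0 x) (Ne.symm hne)
  have hnn : ∀ x₀ y, 0 ≤ partitionOfUnity I M x₀ ((extChartAt I x₀).symm y) *
      (f ((extChartAt I x₀).symm y) * √(gram (chartFrame I x₀ y)).det) := fun x₀ y =>
    mul_nonneg ((partitionOfUnity I M).nonneg _ _) (mul_nonneg (h0 _) (Real.sqrt_nonneg _))
  rw [volIntegral_eq_sum hn, Finset.sum_eq_zero_iff_of_nonneg
    fun x₀ _ => integral_nonneg (hnn x₀)] at h
  obtain ⟨x₀, hx₀⟩ : ∃ x₀, 0 < partitionOfUnity I M x₀ x :=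
    (partitionOfUnity I M).exists_pos_of_mem (mem_univ x)
  have hz := h x₀ (by
    rw [Finite.mem_toFinset]
    intro hc
    rw [hc] at hx₀
    exact lt_irrefl _ hx₀)
  have hcg := continuousOn_mul_sqrt_det_gram (I := I) hf x₀
  rw [setIntegral_eq_zero_iff_of_nonneg_ae (Filter.Eventually.of_forall (hnn x₀))
    (integrableOn_partitionOfUnity_mul x₀ hcg)] at hz
  have hc : ContinuousOn (fun y => partitionOfUnity I M x₀ ((extChartAt I x₀).symm y) *
      (f ((extChartAt I x₀).symm y) * √(gram (chartFrame I x₀ y)).det))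
      (extChartAt I x₀).target :=
    ((partitionOfUnity I M x₀).contMDiff.continuous.comp_continuousOn
      (continuousOn_extChartAt_symm x₀)).mul hcg
  -- At the image of `x` the cutoff, `f` and `√det g` are all positive. The integrand is then
  -- positive on a nonempty relatively open set, which has positive volume, against its vanishing
  -- almost everywhere.
  obtain ⟨U, hU, hUeq⟩ := continuousOn_iff'.1 hc (Ioi 0) isOpen_Ioi
  have hxs : x ∈ (extChartAt I x₀).source :=
    tsupport_partitionOfUnity_subset x₀ (subset_tsupport _ hx₀.ne')
  have hyt := (extChartAt I x₀).map_source hxs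
  have hmem : extChartAt I x₀ x ∈ U ∩ (extChartAt I x₀).target := by
    rw [← hUeq]
    refine ⟨?_, hyt⟩
    have hinv := (extChartAt I x₀).left_inv hxs
    have hd : 0 < (gram (chartFrame I x₀ (extChartAt I x₀ x))).det := by
      refine lt_of_le_of_ne ?_ (det_gram_chartFrame_ne_zero x₀ hyt).symm
      rw [← chartPullback_volForm_sq o]
      positivity
    exact mul_pos (by rwa [hinv]) (mul_pos (by rwa [hinv]) (Real.sqrt_pos.2 hd))
  have hvol := volume_inter_target_pos x₀ hU ⟨_, hmem⟩
  refine hvol.ne' ?_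
  rw [Filter.EventuallyEq, ae_restrict_iff' (measurableSet_extChartAt_target x₀), ae_iff] at hz
  refine measure_mono_null (fun y hy => ?_) hz
  rw [← hUeq] at hy
  exact fun hc => (ne_of_gt hy.1) (hc hy.2)

end VolIntegral

/-! ### The energies as integrals, uniqueness, and derivatives. -/

section Functionals

variable {n : ℕ} {H : Type*} [TopologicalSpace H]
  {I : ModelWithCorners ℝ (EuclideanSpace ℝ (Fin n)) H}
  {M : Type*} [TopologicalSpace M] [ChartedSpace H M]
  [RiemannianBundle (fun x : M => TangentSpace I x)]

theorem density_add_smul (o : ManifoldOrientation I M) (μ δ : DiffForm I M n) (ε : ℝ) (x : M) :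
    density o (μ + ε • δ) x = density o μ x + ε * density o δ x := by
  simp only [density, hodgeStar, hodge_apply]
  exact (contract_add_left (⇑(μ x)) (ε • ⇑(δ x)) _).trans (by rw [contract_smul_left])

theorem momentum_velocityForm (hn : 1 ≤ n) (o : ManifoldOrientation I M) (α : DiffForm I M 1)
    {μ : DiffForm I M n} (hμ0 : ∀ x, density o μ x ≠ 0) :
    momentum hn o (velocityForm hn o α μ) μ = α := by
  funext x
  rw [momentum, hodgeStar, velocityForm, hodge_smul, hodgeStar, hodge_hodge_one, smul_smul,
    smul_smul]
  have h1 : (-1 : ℝ) ^ (n - 1) * (-1) ^ (n - 1) = 1 := by rw [← mul_pow]; simp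
  have h2 : (-1 : ℝ) ^ (n - 1) * density o μ x * (density o μ x)⁻¹ * (-1) ^ (n - 1) = 1 := by
    rw [mul_assoc ((-1 : ℝ) ^ (n - 1)), mul_inv_cancel₀ (hμ0 x), mul_one, h1]
  rw [h2, one_smul]

theorem momentum_injective (hn : 1 ≤ n) (o : ManifoldOrientation I M)
    {μ : DiffForm I M n} (hμ0 : ∀ x, density o μ x ≠ 0) {β β' : DiffForm I M (n - 1)}
    (h : momentum hn o β μ = momentum hn o β' μ) : β = β' := by
  funext x
  have hx := congrFun h x
  have h0 : (-1 : ℝ) ^ (n - 1) * density o μ x ≠ 0 :=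
    mul_ne_zero (pow_ne_zero _ (by norm_num)) (hμ0 x)
  exact hodge_injective (o.orient x) (Nat.sub_add_cancel hn) (smul_right_injective _ h0 hx)

variable [IsManifold I ∞ M] [CompactSpace M] [T2Space M]

theorem pairing_eq_volIntegral {k l : ℕ} (o : ManifoldOrientation I M) (h : k + l = n)
    {a : DiffForm I M k} {b : DiffForm I M l} {F : M → ℝ}
    (hF : ∀ x, wedge h (a x) (b x) = F x • (o.orient x).volumeForm) :
    pairing o h a b = volIntegral o F := by
  rw [pairing, volIntegral]
  congr 1
  funext x
  exact hF x

theorem lagrangian_eq (hn : 1 ≤ n) (o : ManifoldOrientation I M) (β : DiffForm I M (n - 1))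
    (μ : DiffForm I M n) : lagrangian hn o β μ =
      volIntegral o fun x => 1 / 2 * density o μ x * contract (β x) (β x) := by
  rw [lagrangian, volIntegral]
  congr 1
  funext x
  rw [hodgeStar, wedge_hodge, smul_smul, volForm]

theorem hamiltonian_eq (hn : 1 ≤ n) (o : ManifoldOrientation I M) (α : DiffForm I M 1)
    (μ : DiffForm I M n) : hamiltonian hn o α μ =
      volIntegral o fun x => 1 / (2 * density o μ x) * contract (α x) (α x) := by
  rw [hamiltonian, volIntegral]
  congr 1
  funext x
  rw [hodgeStar, wedge_hodge, smul_smul, volForm]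

theorem pairing_hodgeStar {k l : ℕ} (o : ManifoldOrientation I M) (h : k + l = n)
    (a b : DiffForm I M k) :
    pairing o h a (hodgeStar o h b) = volIntegral o fun x => contract (a x) (b x) :=
  pairing_eq_volIntegral o h fun x => wedge_hodge (o.orient x) h (a x) (b x)

theorem pairing_hodgeStar_left (o : ManifoldOrientation I M) (h : (n - 1) + 1 = n)
    (h' : 1 + (n - 1) = n) (a b : DiffForm I M (n - 1)) :
    pairing o h' (hodgeStar o h b) a =
      volIntegral o fun x => (-1) ^ (n - 1) * contract (a x) (b x) :=
  pairing_eq_volIntegral o h' fun x => by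
    rw [wedge_comm_one h h', hodgeStar, wedge_hodge, smul_smul]

/-- The factor `2 * (1 / 2 * ρ)` is left unsimplified to match `hasDerivAt_volIntegral_contract`
with weight `ρ / 2`. The sign in the momentum cancels the one from commuting the wedge. -/
theorem pairing_momentum (hn : 1 ≤ n) (o : ManifoldOrientation I M) (β δ : DiffForm I M (n - 1))
    (μ : DiffForm I M n) : pairing o (Nat.add_sub_of_le hn) (momentum hn o β μ) δ =
      volIntegral o fun x => 2 * (1 / 2 * density o μ x) * contract (β x) (δ x) :=
  pairing_eq_volIntegral o _ fun x => by
    rw [momentum, wedge_smul_left, wedge_comm_one (Nat.sub_add_cancel hn), hodgeStar,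
      wedge_hodge, smul_smul, smul_smul, contract_comm]
    congr 1
    have : ((-1 : ℝ) ^ (n - 1)) * (-1) ^ (n - 1) = 1 := by
      rw [← mul_pow]; simp
    linear_combination (density o μ x * contract (β x) (δ x)) * this

theorem pairing_velocityForm (hn : 1 ≤ n) (o : ManifoldOrientation I M) (α δ : DiffForm I M 1)
    (μ : DiffForm I M n) : pairing o (Nat.add_sub_of_le hn) δ (velocityForm hn o α μ) =
      volIntegral o fun x => 2 * (1 / (2 * density o μ x)) * contract (α x) (δ x) :=
  pairing_eq_volIntegral o _ fun x => by
    rw [velocityForm, wedge_smul_right, hodgeStar, wedge_hodge, smul_smul, contract_comm]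
    congr 2
    rw [one_div, mul_inv, ← mul_assoc, mul_inv_cancel₀ two_ne_zero, one_mul]

theorem pairing_massEffort (o : ManifoldOrientation I M) (α : DiffForm I M 1)
    (μ δ : DiffForm I M n) : pairing o (Nat.zero_add n) (massEffort o α μ) δ =
      volIntegral o fun x =>
        -(1 / (2 * density o μ x ^ 2)) * contract (α x) (α x) * density o δ x :=
  pairing_eq_volIntegral o _ fun x => by
    rw [wedge_zero_left, massEffort, AlternatingMap.smul_apply, contract_one_self, smul_eq_mul]
    exact (congrArg _ (eq_density_smul (o.orient x) (Nat.add_zero n) (δ x))).trans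
      (smul_smul _ _ _)

theorem hamiltonian_momentum (hn : 1 ≤ n) (o : ManifoldOrientation I M)
    (β : DiffForm I M (n - 1)) {μ : DiffForm I M n} (hμ0 : ∀ x, density o μ x ≠ 0) :
    hamiltonian hn o (momentum hn o β μ) μ =
      pairing o (Nat.add_sub_of_le hn) (momentum hn o β μ) β - lagrangian hn o β μ := by
  -- The momentum map is injective and `velocityForm` is a right inverse of it, hence also a left
  -- inverse.
  have hβ : velocityForm hn o (momentum hn o β μ) μ = β :=
    momentum_injective hn o hμ0 (momentum_velocityForm hn o _ hμ0)
  have h1 : pairing o (Nat.add_sub_of_le hn) (momentum hn o β μ) β =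
      2 * lagrangian hn o β μ := by
    rw [pairing_momentum, lagrangian_eq, ← volIntegral_const_mul hn]
    simp only [mul_assoc]
  have h2 : pairing o (Nat.add_sub_of_le hn) (momentum hn o β μ) β =
      2 * hamiltonian hn o (momentum hn o β μ) μ := by
    nth_rewrite 2 [← hβ]
    rw [pairing_velocityForm, hamiltonian_eq, ← volIntegral_const_mul hn]
    simp only [mul_assoc]
  linarith

variable
    [IsContMDiffRiemannianBundle I ∞ (EuclideanSpace ℝ (Fin n)) (fun x : M => TangentSpace I x)]

theorem eq_of_volIntegral_contract_sub {k : ℕ} (hn : 1 ≤ n) (o : ManifoldOrientation I M)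
    {d d' : DiffForm I M k} (hd : IsSmoothForm d) (hd' : IsSmoothForm d')
    (h : volIntegral o (fun x => contract (d x) ((d - d') x)) =
      volIntegral o (fun x => contract (d' x) ((d - d') x))) : d = d' := by
  have hc := hd.sub hd'
  have hsplit : (fun x => contract (d x) ((d - d') x)) = fun x =>
      contract (d' x) ((d - d') x) + contract ((d - d') x) ((d - d') x) := by
    funext x
    rw [← contract_add_left]
    congr 1
    funext v
    simp
  rw [hsplit, volIntegral_add hn o (isSmoothFun_contract hd' hc).continuous
    (isSmoothFun_contract hc hc).continuous, add_eq_left] at h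
  funext x
  have := eq_zero_of_volIntegral_eq_zero hn o (isSmoothFun_contract hc hc).continuous
    (fun x => contract_self_nonneg _) h x
  exact sub_eq_zero.1 (eq_zero_of_contract_self this)

theorem eq_of_pairing_eq {k l : ℕ} (hn : 1 ≤ n) (o : ManifoldOrientation I M) (h : k + l = n)
    {d d' : DiffForm I M k} (hd : IsSmoothForm d) (hd' : IsSmoothForm d')
    (hp : ∀ δ, IsSmoothForm δ → pairing o h d δ = pairing o h d' δ) : d = d' := by
  have := hp _ (isSmoothForm_hodgeStar hn h o (hd.sub hd'))
  rw [pairing_hodgeStar, pairing_hodgeStar] at this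
  exact eq_of_volIntegral_contract_sub hn o hd hd' this

/-- The derivative with respect to `α` pairs with the direction on the left. The test form is again
the star of the difference, now with a sign `(-1)^(n-1)` that cancels. -/
theorem eq_of_pairing_left_eq (hn : 1 ≤ n) (o : ManifoldOrientation I M) (h : 1 + (n - 1) = n)
    {d d' : DiffForm I M (n - 1)} (hd : IsSmoothForm d) (hd' : IsSmoothForm d')
    (hp : ∀ δ, IsSmoothForm δ → pairing o h δ d = pairing o h δ d') : d = d' := by
  have := hp _ (isSmoothForm_hodgeStar hn (Nat.sub_add_cancel hn) o (hd.sub hd'))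
  rw [pairing_hodgeStar_left, pairing_hodgeStar_left, volIntegral_const_mul hn,
    volIntegral_const_mul hn] at this
  exact eq_of_volIntegral_contract_sub hn o hd hd'
    (mul_left_cancel₀ (pow_ne_zero _ (by norm_num)) this)

theorem hasDerivAt_volIntegral_contract {k : ℕ} (hn : 1 ≤ n) (o : ManifoldOrientation I M)
    {w : M → ℝ} (hw : Continuous w) {a b : DiffForm I M k} (ha : IsSmoothForm a)
    (hb : IsSmoothForm b) :
    HasDerivAt (fun ε : ℝ => volIntegral o fun x =>
      w x * contract ((a + ε • b) x) ((a + ε • b) x))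
      (volIntegral o fun x => 2 * w x * contract (a x) (b x)) 0 := by
  have haa := (isSmoothFun_contract ha ha).continuous
  have hab := (isSmoothFun_contract ha hb).continuous
  have hbb := (isSmoothFun_contract hb hb).continuous
  -- Expanding the square gives an exact quadratic polynomial in `ε`, so no differentiation under
  -- the integral is needed.
  have key : (fun ε : ℝ => volIntegral o fun x =>
      w x * contract ((a + ε • b) x) ((a + ε • b) x)) = fun ε =>
      volIntegral o (fun x => w x * contract (a x) (a x)) +
        (ε * volIntegral o (fun x => 2 * w x * contract (a x) (b x)) +
          ε ^ 2 * volIntegral o (fun x => w x * contract (b x) (b x))) := by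
    funext ε
    rw [← volIntegral_const_mul hn, ← volIntegral_const_mul hn, ← volIntegral_add hn o,
      ← volIntegral_add hn o]
    · congr 1
      funext x
      have : (⇑((a + ε • b) x) : (Fin k → TangentSpace I x) → ℝ) = ⇑(a x) + ε • ⇑(b x) := rfl
      rw [this, contract_add_left, contract_add_right, contract_add_right, contract_smul_left,
        contract_smul_right, contract_smul_left, contract_smul_right, contract_comm (b x) (a x)]
      ring
    all_goals fun_prop
  rw [key]
  set A := volIntegral o (fun x => w x * contract (a x) (a x))
  set B := volIntegral o (fun x => 2 * w x * contract (a x) (b x))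
  set C := volIntegral o (fun x => w x * contract (b x) (b x))
  have := (((hasDerivAt_id (0 : ℝ)).mul_const B).add
    (((hasDerivAt_id (0 : ℝ)).pow 2).mul_const C)).const_add A
  simpa using this

theorem hasDerivAt_volIntegral_inv (hn : 1 ≤ n) (o : ManifoldOrientation I M) {ρ σ q : M → ℝ}
    (hρ : Continuous ρ) (hσ : Continuous σ) (hq : Continuous q) (h0 : ∀ x, ρ x ≠ 0) :
    HasDerivAt (fun ε : ℝ => volIntegral o fun x => 1 / (2 * (ρ x + ε * σ x)) * q x)
      (volIntegral o fun x => -(1 / (2 * ρ x ^ 2)) * q x * σ x) 0 := by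
  set D := volIntegral o fun x => -(1 / (2 * ρ x ^ 2)) * q x * σ x
  have hρi : Continuous fun x => (ρ x)⁻¹ := hρ.inv₀ h0
  obtain ⟨T, hT⟩ := isCompact_univ.exists_bound_of_continuousOn
    (hσ.mul hρi).continuousOn
  -- `T` bounds `|σ/ρ|` and `P` bounds `|(q/ρ)(σ/ρ)²|`, the numerator of the second-order remainder.
  obtain ⟨P, hP⟩ := isCompact_univ.exists_bound_of_continuousOn
    ((hq.mul hρi).mul ((hσ.mul hρi).pow 2)).continuousOn
  simp only [mem_univ, forall_const, Pi.mul_apply, Pi.pow_apply, Real.norm_eq_abs] at hT hP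
  rw [hasDerivAt_iff_isLittleO_nhds_zero]
  refine Asymptotics.IsBigO.trans_isLittleO (g := fun ε : ℝ => ε ^ 2) ?_
    (Asymptotics.isLittleO_pow_id one_lt_two)
  refine Asymptotics.IsBigO.of_bound (volIntegral o fun _ => P) ?_
  -- This makes `1 + ε σ/ρ ≥ 1/2` everywhere, so the denominator `2 (1 + ε σ/ρ)` of the remainder is
  -- at least `1`. The absolute value is taken because `T` is not known to be nonnegative when `M`
  -- is empty.
  have hsmall : ∀ᶠ ε : ℝ in nhds 0, |ε| * |T| < 1 / 2 := by
    have : ContinuousAt (fun ε : ℝ => |ε| * |T|) 0 := by fun_prop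
    exact this.eventually (gt_mem_nhds (by simp))
  filter_upwards [hsmall] with ε hε
  have hb : ∀ x, 1 / 2 ≤ 1 + ε * (σ x * (ρ x)⁻¹) := by
    intro x
    have h1 : |ε * (σ x * (ρ x)⁻¹)| ≤ |ε| * |T| := by
      rw [abs_mul]
      exact mul_le_mul_of_nonneg_left ((hT x).trans (le_abs_self T)) (abs_nonneg _)
    linarith [(abs_le.1 h1).1]
  have hne : ∀ x, ρ x + ε * σ x ≠ 0 := by
    intro x hx
    have : ρ x * (1 + ε * (σ x * (ρ x)⁻¹)) = 0 := by
      rw [← hx]; field_simp [h0 x]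
    rcases mul_eq_zero.1 this with h | h
    · exact h0 x h
    · linarith [hb x]
  -- From `1/(1 + t) = 1 - t + t²/(1 + t)` with `t = ε σ/ρ`, multiplied by `q/(2ρ)`: the last term
  -- is exactly `ε² r`.
  let r := fun x => (q x * (ρ x)⁻¹) * (σ x * (ρ x)⁻¹) ^ 2 * (2 * (1 + ε * (σ x * (ρ x)⁻¹)))⁻¹
  have hrc : Continuous r := by
    refine Continuous.mul (by fun_prop) (Continuous.inv₀ (by fun_prop) fun x => ?_)
    linarith [hb x]
  have hr : ∀ x, |r x| ≤ P := by
    intro x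
    have hpos : 0 < 2 * (1 + ε * (σ x * (ρ x)⁻¹)) := by linarith [hb x]
    calc |r x| = |q x * (ρ x)⁻¹ * (σ x * (ρ x)⁻¹) ^ 2| *
          (2 * (1 + ε * (σ x * (ρ x)⁻¹)))⁻¹ := by
          rw [abs_mul, abs_inv, abs_of_pos hpos]
      _ ≤ |q x * (ρ x)⁻¹ * (σ x * (ρ x)⁻¹) ^ 2| * 1 :=
          mul_le_mul_of_nonneg_left (inv_le_one_of_one_le₀ (by linarith [hb x])) (abs_nonneg _)
      _ ≤ P := by rw [mul_one]; exact hP x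
  have hc1 : Continuous fun x => 1 / (2 * ρ x) :=
    continuous_const.div (continuous_const.mul hρ) fun x => by simpa using h0 x
  have hc2 : Continuous fun x => 1 / (2 * ρ x ^ 2) :=
    continuous_const.div (continuous_const.mul (hρ.pow 2)) fun x => by simpa using h0 x
  have hexp : (volIntegral o fun x => 1 / (2 * (ρ x + ε * σ x)) * q x) =
      (volIntegral o fun x => 1 / (2 * ρ x) * q x) + (ε * D + ε ^ 2 * volIntegral o r) := by
    rw [← volIntegral_const_mul hn, ← volIntegral_const_mul hn, ← volIntegral_add hn o,
      ← volIntegral_add hn o]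
    · congr 1
      funext x
      have h1 := h0 x
      have h2 := hne x
      have h3 : 1 + ε * (σ x * (ρ x)⁻¹) = (ρ x + ε * σ x) / ρ x := by field_simp
      simp only [r, h3]
      field_simp
      ring
    · exact hc1.mul hq
    · exact (continuous_const.mul ((hc2.neg.mul hq).mul hσ)).add (continuous_const.mul hrc)
    · exact continuous_const.mul ((hc2.neg.mul hq).mul hσ)
    · exact continuous_const.mul hrc
  have hz : (volIntegral o fun x => 1 / (2 * (ρ x + 0 * σ x)) * q x) =
      volIntegral o fun x => 1 / (2 * ρ x) * q x := by simp
  rw [zero_add, hexp, hz, smul_eq_mul, norm_pow, Real.norm_eq_abs, Real.norm_eq_abs, sq_abs]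
  have hJ : |volIntegral o r| ≤ volIntegral o fun _ => P := by
    rw [abs_le]
    refine ⟨?_, volIntegral_mono hn o hrc continuous_const fun x => (abs_le.1 (hr x)).2⟩
    have h1 := volIntegral_const_mul hn o (-1) fun _ : M => P
    have h2 := volIntegral_mono hn o (f := fun _ => -1 * P) continuous_const hrc fun x => by
      linarith [(abs_le.1 (hr x)).1]
    linarith
  rw [show ∀ A X Y : ℝ, A + (X + Y) - A - X = Y from fun A X Y => by ring, abs_mul,
    abs_of_nonneg (sq_nonneg ε), mul_comm]
  exact mul_le_mul_of_nonneg_right hJ (sq_nonneg ε)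

end Functionals

/-! ### Variational derivatives and the Legendre transform. -/

section Main

variable {n : ℕ} {H : Type*} [TopologicalSpace H]
  {I : ModelWithCorners ℝ (EuclideanSpace ℝ (Fin n)) H}
  {M : Type*} [TopologicalSpace M] [ChartedSpace H M]
  [IsManifold I ∞ M]
  [RiemannianBundle (fun x : M => TangentSpace I x)]
  [IsContMDiffRiemannianBundle I ∞ (EuclideanSpace ℝ (Fin n)) (fun x : M => TangentSpace I x)]

theorem isSmoothForm_momentum (hn : 1 ≤ n) (o : ManifoldOrientation I M)
    {β : DiffForm I M (n - 1)} {μ : DiffForm I M n} (hβ : IsSmoothForm β) (hμ : IsSmoothForm μ) :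
    IsSmoothForm (momentum hn o β μ) :=
  IsSmoothForm.smul (f := fun x => (-1) ^ (n - 1) * density o μ x)
    (fun x₀ => contDiffOn_const.mul (isSmoothFun_density hn o hμ x₀))
    (isSmoothForm_hodgeStar hn _ o hβ)

theorem isSmoothForm_velocityForm (hn : 1 ≤ n) (o : ManifoldOrientation I M) {α : DiffForm I M 1}
    {μ : DiffForm I M n} (hα : IsSmoothForm α) (hμ : IsSmoothForm μ)
    (hμ0 : ∀ x, density o μ x ≠ 0) : IsSmoothForm (velocityForm hn o α μ) :=
  IsSmoothForm.smul (fun x₀ => (isSmoothFun_density hn o hμ x₀).inv fun _ _ => hμ0 _)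
    (isSmoothForm_hodgeStar hn _ o hα)

theorem isSmoothForm_massEffort (hn : 1 ≤ n) (o : ManifoldOrientation I M) {α : DiffForm I M 1}
    {μ : DiffForm I M n} (hα : IsSmoothForm α) (hμ : IsSmoothForm μ)
    (hμ0 : ∀ x, density o μ x ≠ 0) : IsSmoothForm (massEffort o α μ) := by
  refine IsSmoothForm.smul (f := fun x => -(1 / (2 * density o μ x ^ 2))) (fun x₀ => ?_)
    (fun x₀ v => ?_)
  · exact (contDiffOn_const.div (contDiffOn_const.mul ((isSmoothFun_density hn o hμ x₀).pow 2))
      fun y _ => mul_ne_zero two_ne_zero (pow_ne_zero 2 (hμ0 _))).neg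
  · exact (isSmoothFun_contract hα hα x₀).congr fun y _ =>
      contract_one_self (α ((extChartAt I x₀).symm y)) _

variable [CompactSpace M] [T2Space M]

theorem isVariationalDeriv_lagrangian (hn : 1 ≤ n) (o : ManifoldOrientation I M)
    {β : DiffForm I M (n - 1)} {μ : DiffForm I M n} (hβ : IsSmoothForm β) (hμ : IsSmoothForm μ) :
    IsVariationalDeriv (fun α δβ => pairing o (Nat.add_sub_of_le hn) α δβ)
      (fun β' => lagrangian hn o β' μ) β (momentum hn o β μ) := by
  have hm := isSmoothForm_momentum hn o hβ hμ
  have hρ := (isSmoothFun_density hn o hμ).continuous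
  have hrep : RepresentsDeriv (fun α δβ => pairing o (Nat.add_sub_of_le hn) α δβ)
      (fun β' => lagrangian hn o β' μ) β (momentum hn o β μ) := by
    intro δ hδ
    simp only [lagrangian_eq, pairing_momentum]
    exact hasDerivAt_volIntegral_contract hn o (continuous_const.mul hρ) hβ hδ
  exact ⟨hm, hrep, fun d' hd' hr => eq_of_pairing_eq hn o _ hd' hm fun δ hδ =>
    (hr δ hδ).unique (hrep δ hδ)⟩

theorem isVariationalDeriv_hamiltonian_form (hn : 1 ≤ n) (o : ManifoldOrientation I M)
    {α : DiffForm I M 1} {μ : DiffForm I M n} (hα : IsSmoothForm α) (hμ : IsSmoothForm μ)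
    (hμ0 : ∀ x, density o μ x ≠ 0) :
    IsVariationalDeriv (fun β δα => pairing o (Nat.add_sub_of_le hn) δα β)
      (fun α' => hamiltonian hn o α' μ) α (velocityForm hn o α μ) := by
  have hv := isSmoothForm_velocityForm hn o hα hμ hμ0
  have hρ := (isSmoothFun_density hn o hμ).continuous
  have hrep : RepresentsDeriv (fun β δα => pairing o (Nat.add_sub_of_le hn) δα β)
      (fun α' => hamiltonian hn o α' μ) α (velocityForm hn o α μ) := by
    intro δ hδ
    simp only [hamiltonian_eq, pairing_velocityForm]
    exact hasDerivAt_volIntegral_contract hn o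
      (continuous_const.div (continuous_const.mul hρ) fun x => mul_ne_zero two_ne_zero (hμ0 x))
      hα hδ
  exact ⟨hv, hrep, fun d' hd' hr => eq_of_pairing_left_eq hn o _ hd' hv fun δ hδ =>
    (hr δ hδ).unique (hrep δ hδ)⟩

theorem isVariationalDeriv_hamiltonian_mass (hn : 1 ≤ n) (o : ManifoldOrientation I M)
    {α : DiffForm I M 1} {μ : DiffForm I M n} (hα : IsSmoothForm α) (hμ : IsSmoothForm μ)
    (hμ0 : ∀ x, density o μ x ≠ 0) :
    IsVariationalDeriv (fun f δμ => pairing o (Nat.zero_add n) f δμ)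
      (fun μ' => hamiltonian hn o α μ') μ (massEffort o α μ) := by
  have hm := isSmoothForm_massEffort hn o hα hμ hμ0
  have hrep : RepresentsDeriv (fun f δμ => pairing o (Nat.zero_add n) f δμ)
      (fun μ' => hamiltonian hn o α μ') μ (massEffort o α μ) := by
    intro δ hδ
    simp only [hamiltonian_eq, pairing_massEffort, density_add_smul]
    exact hasDerivAt_volIntegral_inv hn o (isSmoothFun_density hn o hμ).continuous
      (isSmoothFun_density hn o hδ).continuous (isSmoothFun_contract hα hα).continuous hμ0
  exact ⟨hm, hrep, fun d' hd' hr => eq_of_pairing_eq hn o _ hd' hm fun δ hδ =>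
    (hr δ hδ).unique (hrep δ hδ)⟩

theorem isLegendreTransform_lagrangian (hn : 1 ≤ n) (o : ManifoldOrientation I M)
    {μ : DiffForm I M n} (hμ : IsSmoothForm μ) (hμ0 : ∀ x, density o μ x ≠ 0) :
    IsLegendreTransform (fun α β => pairing o (Nat.add_sub_of_le hn) α β)
      (fun β => lagrangian hn o β μ) (fun α => hamiltonian hn o α μ) := by
  -- Uniqueness of the variational derivative turns the abstract conjugate momentum into the
  -- explicit formula, so the remaining claims concern the map `momentum` alone.
  have hmom : ∀ {β α}, IsSmoothForm β →
      IsVariationalDeriv (fun α β => pairing o (Nat.add_sub_of_le hn) α β)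
        (fun β => lagrangian hn o β μ) β α → α = momentum hn o β μ := fun hβ h =>
    (isVariationalDeriv_lagrangian hn o hβ hμ).2.2 _ h.1 h.2.1
  refine ⟨fun β hβ => ⟨_, isVariationalDeriv_lagrangian hn o hβ hμ⟩, fun α hα => ?_, ?_⟩
  · have hv := isSmoothForm_velocityForm hn o hα hμ hμ0
    have hmv := momentum_velocityForm hn o α hμ0
    refine ⟨velocityForm hn o α μ, ⟨hv, ?_⟩, fun β' h => ?_⟩
    · have := isVariationalDeriv_lagrangian hn o hv hμ
      rwa [hmv] at this
    · exact momentum_injective hn o hμ0 ((hmom h.1 h.2).symm.trans hmv.symm)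
  · intro β α hβ h
    rw [hmom hβ h]
    exact hamiltonian_momentum hn o β hμ0

end Main

end FluidKinetic

theorem theorem2 {n : ℕ} (hn : 1 ≤ n) {H : Type*} [TopologicalSpace H]
    (I : ModelWithCorners ℝ (EuclideanSpace ℝ (Fin n)) H)
    (M : Type*) [TopologicalSpace M] [ChartedSpace H M] [IsManifold I ∞ M]
    [CompactSpace M] [T2Space M]
    [RiemannianBundle (fun x : M => TangentSpace I x)]
    [IsContMDiffRiemannianBundle I ∞ (EuclideanSpace ℝ (Fin n)) (fun x : M => TangentSpace I x)]
    (o : ManifoldOrientation I M)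
    (μ : DiffForm I M n) (hμ : IsSmoothForm μ) (hμ0 : ∀ x, density o μ x ≠ 0) :
    -- `(-1)^(n-1) (*μ) *β` is the momentum conjugate to `β`
    (∀ β : DiffForm I M (n - 1), IsSmoothForm β →
      IsVariationalDeriv (fun α δβ => pairing o (Nat.add_sub_of_le hn) α δβ)
        (fun β' => lagrangian hn o β' μ) β (momentum hn o β μ)) ∧
    -- `H_k(·, μ)` is the Legendre transform of `L_k(·, μ)`
    IsLegendreTransform (fun α β => pairing o (Nat.add_sub_of_le hn) α β)
      (fun β => lagrangian hn o β μ) (fun α => hamiltonian hn o α μ) ∧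
    -- the variational derivatives of `H_k`
    ∀ α : DiffForm I M 1, IsSmoothForm α →
      IsVariationalDeriv (fun β δα => pairing o (Nat.add_sub_of_le hn) δα β)
        (fun α' => hamiltonian hn o α' μ) α (velocityForm hn o α μ) ∧
      IsVariationalDeriv (fun f δμ => pairing o (Nat.zero_add n) f δμ)
        (fun μ' => hamiltonian hn o α μ') μ (massEffort o α μ) := by
  exact ⟨fun β hβ => isVariationalDeriv_lagrangian hn o hβ hμ,
    isLegendreTransform_lagrangian hn o hμ hμ0,
    fun α hα => ⟨isVariationalDeriv_hamiltonian_form hn o hα hμ hμ0,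
      isVariationalDeriv_hamiltonian_mass hn o hα hμ hμ0⟩⟩
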